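/- **Proposition 3.8.** Let $\mathcal{T}$ be a finite simplicial complex, i.e. a finite set of finite non-empty sets (simplexes) containing every non-empty subset of each of its elements. For each simplex $T\in\mathcal{T}$ let $\rho_T$ be an injection of $T$ into a real affine space $V_T$ with affinely independent image; let $|T|$ be the convex hull of $\rho_T(T)$ and, for $T'\subset T$, let $i_{TT'}:|T'|\to|T|$ be the affine map with $i_{TT'}(\rho_{T'}(j))=\rho_T(j)$ for $j\in T'$. Fix for each $k$-simplex $T$ (a simplex with $k+1$ elements) a bijection $\sigma_T:\{0,\dots,k\}\to T$. For $k\ge 0$ let $\Omega^k(\mathcal{T})$ be the real vector space of families $u=(u_T)_{T\in\mathcal{T}}$, where $u_T$ is a smooth differential $k$-form on $|T|$ (i.e. one with a smooth extension to the affine space generated by $|T|$) and $(i_{TT'})^\star u_T=u_{T'}$ whenever $T'\subset T$ are simplexes of $\mathcal{T}$. Let $\mathrm{d}:\Omega^k(\mathcal{T})\to\Omega^{k+1}(\mathcal{T})$ be the componentwise exterior derivative. For a vertex $i$ let $\lambda_i\in\Omega^0(\mathcal{T})$ be the function which on $|T|$ is the barycentric coordinate relative to $i$ if $i\in T$, and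 is $0$ otherwise. For a $k$-simplex $T$ put $$\lambda_T = k!\sum_{i=0}^{k}(-1)^i\,\lambda_{\sigma_T(i)}\,\mathrm{d}\lambda_{\sigma_T(0)}\wedge\cdots\widehat{\mathrm{d}\lambda_{\sigma_T(i)}}\cdots\wedge\mathrm{d}\lambda_{\sigma_T(k)}$$ (the hat denotes omission; for $k=0$ and $T=\{i\}$ this is $\lambda_i$), and let $\Lambda^k(\mathcal{T})\subset\Omega^k(\mathcal{T})$ be the linear span of the $\lambda_T$, $T$ ranging over the $k$-simplexes of $\mathcal{T}$. Let $\Gamma^k(\mathcal{T})$, $k\ge0$, be linear subspaces with $\Lambda^k(\mathcal{T})\subset\Gamma^k(\mathcal{T})\subset\Omega^k(\mathcal{T})$ and $\mathrm{d}\,\Gamma^k(\mathcal{T})\subset\Gamma^{k+1}(\mathcal{T})$. Let $\Pi_\Gamma:\Omega^k(\mathcal{T})\to\Gamma^k(\mathcal{T})$ and $\Pi_\Lambda:\Omega^k(\mathcal{T})\to\Lambda^k(\mathcal{T})$, $k\ge0$, be linear projectors with ranges $\Gamma^k(\mathcal{T})$ and $\Lambda^k(\mathcal{T})$ respectively, both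 commuting with $\mathrm{d}$. Suppose that $\Pi_\Lambda\circ\Pi_\Gamma=\Pi_\Lambda$ in every degree. Then for every $k\ge 0$ the map $$\mathrm{H}^k\Lambda^\bullet(\mathcal{T})\to\mathrm{H}^k\Gamma^\bullet(\mathcal{T})$$ induced by the inclusion $\Lambda^\bullet(\mathcal{T})\subset\Gamma^\bullet(\mathcal{T})$ is an isomorphism, where $\mathrm{H}^kS^\bullet=\ker(\mathrm{d}:S^k\to S^{k+1})/\mathrm{d}(S^{k-1})$ and $S^{-1}=0$. -/

import Mathlib

set_option maxSynthPendingDepth 3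

open scoped ContDiff

noncomputable section

namespace CompatibleForms

/-! ### Preliminaries on affinely independent families -/

section Affine

variable {J E F : Type*} [NormedAddCommGroup E] [NormedSpace ℝ E] [AddCommGroup F] [Module ℝ F]

theorem exists_affineMap_apply_eq {p : J → E} (hp : AffineIndependent ℝ p) (q : J → F) :
    ∃ φ : E →ᵃ[ℝ] F, ∀ j, φ (p j) = q j := by
  classical
  rcases isEmpty_or_nonempty J with hJ | ⟨⟨j₀⟩⟩
  · exact ⟨AffineMap.const ℝ E 0, fun j => isEmptyElim j⟩
  have hli := (affineIndependent_iff_linearIndependent_vsub ℝ p j₀).1 hp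
  obtain ⟨g, hg⟩ := LinearMap.exists_extend
    ((Module.Basis.span hli).constr ℝ (fun j : {x // x ≠ j₀} => q j - q j₀))
  have hg' : ∀ j : {x // x ≠ j₀}, g (p j - p j₀) = q j - q j₀ := by
    intro j
    have h1 := (Module.Basis.span hli).constr_basis ℝ (fun j : {x // x ≠ j₀} => q j - q j₀) j
    rw [← hg] at h1
    simpa [Module.Basis.span_apply] using h1
  refine ⟨g.toAffineMap + AffineMap.const ℝ E (q j₀ - g (p j₀)), fun j => ?_⟩
  by_cases hj : j = j₀
  · subst hj; simp
  · have := hg' ⟨j, hj⟩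
    simp only [map_sub] at this
    simp only [AffineMap.coe_add, LinearMap.coe_toAffineMap, Pi.add_apply, AffineMap.const_apply]
    rw [sub_eq_iff_eq_add.1 this]; abel

/-- An affine map on the ambient space with prescribed values `q` on an affinely independent
family `p`. Its restriction to the affine span of `p` is the unique affine map on that span with
these values; only this restriction is used below. -/
def affineInterp {p : J → E} (hp : AffineIndependent ℝ p) (q : J → F) : E →ᵃ[ℝ] F :=
  (exists_affineMap_apply_eq hp q).choose

theorem affineInterp_apply {p : J → E} (hp : AffineIndependent ℝ p) (q : J → F) (j : J) :
    affineInterp hp q (p j) = q j :=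
  (exists_affineMap_apply_eq hp q).choose_spec j

end Affine

/-! ### Affine realizations of simplicial complexes -/

/-- An affine realization of a simplicial complex `K`: for each simplex `T`, an injection of the
vertices of `T` into an affine space `V T`, whose range spans an affine subspace of dimension
`dim T`, i.e. is affinely independent. No relation between the realizations of
different simplexes is required. -/
structure AffineRealization {ι : Type*} (K : PreAbstractSimplicialComplex ι) (V : K → Type*)
    [∀ T, NormedAddCommGroup (V T)] [∀ T, NormedSpace ℝ (V T)] where
  /-- the position of the vertices of a simplex -/
  point : ∀ T : K, T.1 → V T
  affineIndependent : ∀ T : K, AffineIndependent ℝ (point T)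

/-- A choice, for each simplex `T`, of a bijection `σ_T : [dim T] → T`. -/
abbrev VertexOrdering {ι : Type*} (K : PreAbstractSimplicialComplex ι) :=
  ∀ T : K, Fin T.1.card ≃ T.1

section Forms

variable {ι : Type*} {K : PreAbstractSimplicialComplex ι} {V : K → Type*}
  [∀ T, NormedAddCommGroup (V T)] [∀ T, NormedSpace ℝ (V T)] (R : AffineRealization K V)

/-- The realization `|T|`: the convex hull of the realized vertices. -/
def carrier (T : K) : Set (V T) := convexHull ℝ (Set.range (R.point T))

/-- The affine subspace generated by `|T|`. -/
def span (T : K) : AffineSubspace ℝ (V T) := affineSpan ℝ (Set.range (R.point T))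

/-- The space of directions of the affine subspace generated by `|T|`, i.e. the tangent space
of `|T|` at any of its points. -/
abbrev dir (T : K) : Submodule ℝ (V T) := vectorSpan ℝ (Set.range (R.point T))

/-- Families `(u_T)` of arbitrary (not necessarily smooth or compatible) differential `k`-forms
on the sets `|T|`. The value at a point of `|T|` is an alternating form on the directions
of `|T|`. -/
abbrev FormFamily (k : ℕ) := ∀ T : K, carrier R T → (dir R T) [⋀^Fin k]→L[ℝ] ℝ

/-- A `k`-form on `|T|` is smooth if it has a smooth extension to the affine space generated
by `|T|`. -/
def IsSmoothForm {k : ℕ} (T : K) (u : carrier R T → (dir R T) [⋀^Fin k]→L[ℝ] ℝ) : Prop :=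
  ∃ θ : V T → (dir R T) [⋀^Fin k]→L[ℝ] ℝ,
    ContDiffOn ℝ ∞ θ (span R T : Set (V T)) ∧ ∀ x : carrier R T, θ x = u x

/-- The canonical injection `i_{TT'} : |T'| → |T|` for `T' ⊆ T`, as an affine map. -/
def incl {T' T : K} (h : T'.1 ⊆ T.1) : V T' →ᵃ[ℝ] V T :=
  affineInterp (R.affineIndependent T') fun j => R.point T ⟨j.1, h j.2⟩

theorem incl_point {T' T : K} (h : T'.1 ⊆ T.1) (j : T'.1) :
    incl R h (R.point T' j) = R.point T ⟨j.1, h j.2⟩ :=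
  affineInterp_apply _ _ j

theorem incl_mem_carrier {T' T : K} (h : T'.1 ⊆ T.1) {x : V T'} (hx : x ∈ carrier R T') :
    incl R h x ∈ carrier R T := by
  have h1 : incl R h x ∈ incl R h '' carrier R T' := ⟨x, hx, rfl⟩
  rw [carrier, AffineMap.image_convexHull, ← Set.range_comp] at h1
  refine convexHull_mono ?_ h1
  rintro _ ⟨j, rfl⟩
  exact ⟨⟨j.1, h j.2⟩, (incl_point R h j).symm⟩

theorem incl_linear_mem_dir {T' T : K} (h : T'.1 ⊆ T.1) (v : V T') (hv : v ∈ dir R T') :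
    (incl R h).linear v ∈ dir R T := by
  have h1 : (incl R h).linear v ∈ (dir R T').map (incl R h).linear := ⟨v, hv, rfl⟩
  rw [dir, AffineMap.map_vectorSpan, ← Set.range_comp] at h1
  refine vectorSpan_mono ℝ ?_ h1
  rintro _ ⟨j, rfl⟩
  exact ⟨⟨j.1, h j.2⟩, (incl_point R h j).symm⟩

/-- The differential of the canonical injection. -/
def inclDir {T' T : K} (h : T'.1 ⊆ T.1) : dir R T' →L[ℝ] dir R T :=
  LinearMap.toContinuousLinearMap ((incl R h).linear.restrict (incl_linear_mem_dir R h))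

theorem coe_inclDir {T' T : K} (h : T'.1 ⊆ T.1) (v : dir R T') :
    (inclDir R h v : V T) = (incl R h).linear v := rfl

/-- The pull-back of a `k`-form by the canonical injection. -/
def pullback {k : ℕ} {T' T : K} (h : T'.1 ⊆ T.1) (u : carrier R T → (dir R T) [⋀^Fin k]→L[ℝ] ℝ) :
    carrier R T' → (dir R T') [⋀^Fin k]→L[ℝ] ℝ :=
  fun x => (u ⟨incl R h x, incl_mem_carrier R h x.2⟩).compContinuousLinearMap (inclDir R h)

/-- The space `Ω^k(K)` of compatible `k`-forms. -/
def Omega (k : ℕ) : Submodule ℝ (FormFamily R k) where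
  carrier := {u | (∀ T, IsSmoothForm R T (u T)) ∧
    ∀ (T' T : K) (h : T'.1 ⊆ T.1), pullback R h (u T) = u T'}
  add_mem' := by
    rintro u v ⟨hu, hu'⟩ ⟨hv, hv'⟩
    refine ⟨fun T => ?_, fun T' T h => ?_⟩
    · obtain ⟨θ, h1, h2⟩ := hu T
      obtain ⟨η, h3, h4⟩ := hv T
      exact ⟨fun x => θ x + η x, h1.add h3, fun x => by simp [h2, h4]⟩
    · funext x
      rw [Pi.add_apply, Pi.add_apply, ← hu' T' T h, ← hv' T' T h]
      rfl
  zero_mem' := ⟨fun T => ⟨fun _ => 0, contDiffOn_const, fun x => rfl⟩, fun T' T h => rfl⟩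
  smul_mem' := by
    rintro c u ⟨hu, hu'⟩
    refine ⟨fun T => ?_, fun T' T h => ?_⟩
    · obtain ⟨θ, h1, h2⟩ := hu T
      exact ⟨fun x => c • θ x, h1.const_smul c, fun x => by simp [h2]⟩
    · funext x
      rw [Pi.smul_apply, Pi.smul_apply, ← hu' T' T h]
      rfl

/-! ### The exterior derivative -/

/-- The set of directions `v` such that `x + v ∈ |T|`: the realization `|T|` seen from `x` in the
chart `v ↦ x + v` of the affine space it generates. -/
def chartSet (T : K) (x : V T) : Set (dir R T) := {v | x + (v : V T) ∈ carrier R T}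

open Classical in
/-- The form `u` on `|T|` in the chart `v ↦ x + v` (extended by `0` outside of `chartSet`). -/
def chartForm {k : ℕ} (T : K) (u : carrier R T → (dir R T) [⋀^Fin k]→L[ℝ] ℝ) (x : V T)
    (v : dir R T) : (dir R T) [⋀^Fin k]→L[ℝ] ℝ :=
  if h : x + (v : V T) ∈ carrier R T then u ⟨x + v, h⟩ else 0

/-- The exterior derivative of a form on `|T|`. -/
def extDerivForm {k : ℕ} (T : K) (u : carrier R T → (dir R T) [⋀^Fin k]→L[ℝ] ℝ) :
    carrier R T → (dir R T) [⋀^Fin (k + 1)]→L[ℝ] ℝ :=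
  fun x => extDerivWithin (chartForm R T u x) (chartSet R T x) 0

theorem nonempty_simplex (T : K) : Nonempty T.1 :=
  (K.isRelLowerSet_faces T.2).1.to_subtype

theorem carrier_subset_span (T : K) : carrier R T ⊆ span R T :=
  convexHull_subset_affineSpan _

theorem add_mem_span {T : K} {x : V T} (hx : x ∈ span R T) (v : dir R T) :
    x + (v : V T) ∈ span R T := by
  have := AffineSubspace.vadd_mem_of_mem_direction (s := span R T) (v := (v : V T))
    (by rw [span, direction_affineSpan]; exact v.2) hx
  rwa [vadd_eq_add, add_comm] at this

theorem sub_mem_dir {T : K} {x y : V T} (hx : x ∈ span R T) (hy : y ∈ span R T) :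
    y - x ∈ dir R T := by
  have := AffineSubspace.vsub_mem_direction hy hx
  rwa [span, direction_affineSpan] at this

theorem uniqueDiffOn_chartSet {T : K} (x : V T) (hx : x ∈ span R T) :
    UniqueDiffOn ℝ (chartSet R T x) := by
  have hp : ∀ j, R.point T j ∈ span R T := fun j => subset_affineSpan ℝ _ ⟨j, rfl⟩
  set q : T.1 → dir R T := fun j => ⟨R.point T j - x, sub_mem_dir R hx (hp j)⟩ with hq
  have himg : ⇑(AffineMap.const ℝ (dir R T) x + (dir R T).subtype.toAffineMap) ∘ q
      = R.point T := by
    funext j; simp [hq]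
  have hset : chartSet R T x = convexHull ℝ (Set.range q) := by
    have h1 : (AffineMap.const ℝ (dir R T) x + (dir R T).subtype.toAffineMap) ''
        convexHull ℝ (Set.range q) = carrier R T := by
      rw [AffineMap.image_convexHull, ← Set.range_comp, himg, carrier]
    ext v
    rw [chartSet, Set.mem_ofPred_eq, ← h1]
    constructor
    · rintro ⟨w, hw, hwv⟩
      have : w = v := by
        apply Subtype.ext
        simpa using hwv
      exact this ▸ hw
    · intro hv
      exact ⟨v, hv, by simp⟩
  rw [hset]
  have := nonempty_simplex T
  refine uniqueDiffOn_convex (convex_convexHull ℝ _) ?_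
  rw [interior_convexHull_nonempty_iff_affineSpan_eq_top,
    AffineSubspace.affineSpan_eq_top_iff_vectorSpan_eq_top_of_nonempty ℝ _ _
      (Set.range_nonempty q)]
  apply Submodule.map_injective_of_injective (dir R T).injective_subtype
  have h2 := AffineMap.map_vectorSpan (k := ℝ)
    (f := AffineMap.const ℝ (dir R T) x + (dir R T).subtype.toAffineMap) (s := Set.range q)
  rw [← Set.range_comp, himg] at h2
  have h3 : (AffineMap.const ℝ (dir R T) x + (dir R T).subtype.toAffineMap).linear
      = (dir R T).subtype := by simp
  rw [h3] at h2
  rw [h2]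
  simp

/-- The exterior derivative on `|T|` is the restriction of the exterior derivative of any
extension that is differentiable along the affine space generated by `|T|`. -/
theorem extDerivForm_eq {k : ℕ} {T : K} {u : carrier R T → (dir R T) [⋀^Fin k]→L[ℝ] ℝ}
    {θ : V T → (dir R T) [⋀^Fin k]→L[ℝ] ℝ} (hθ : ∀ y : carrier R T, θ y = u y)
    (x : carrier R T) (hd : DifferentiableAt ℝ (fun v : dir R T => θ (x + v)) 0) :
    extDerivForm R T u x = extDeriv (fun v : dir R T => θ (x + v)) 0 := by
  have h0 : (0 : dir R T) ∈ chartSet R T x := by simp [chartSet]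
  have h1 : extDerivForm R T u x
      = extDerivWithin (fun v : dir R T => θ (x + v)) (chartSet R T x) 0 := by
    refine extDerivWithin_congr' (fun v hv => ?_) h0
    have hv' : (x : V T) + v ∈ carrier R T := hv
    simp only [chartForm, dif_pos hv']
    exact (hθ ⟨_, hv'⟩).symm
  rw [h1, extDerivWithin, extDeriv,
    hd.fderivWithin (uniqueDiffOn_chartSet R _ (carrier_subset_span R T x.2) 0 h0)]

theorem contDiff_chart {k : ℕ} {T : K} {θ : V T → (dir R T) [⋀^Fin k]→L[ℝ] ℝ}
    (hθ : ContDiffOn ℝ ∞ θ (span R T : Set (V T))) {x : V T} (hx : x ∈ span R T) :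
    ContDiff ℝ ∞ (fun v : dir R T => θ (x + v)) := by
  rw [← contDiffOn_univ]
  exact hθ.comp (contDiff_const.add (dir R T).subtypeL.contDiff).contDiffOn
    fun v _ => add_mem_span R hx v

theorem two_le_infty : (2 : WithTop ℕ∞) ≤ ∞ := by
  exact WithTop.coe_le_coe.2 (le_top : (2 : ℕ∞) ≤ ⊤)

theorem contDiff_extDeriv {E : Type*} [NormedAddCommGroup E] [NormedSpace ℝ E] {k : ℕ}
    {g : E → E [⋀^Fin k]→L[ℝ] ℝ} (hg : ContDiff ℝ ∞ g) : ContDiff ℝ ∞ (extDeriv g) :=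
  (ContinuousAlternatingMap.alternatizeUncurryFinCLM ℝ E ℝ).contDiff.comp
    (f := fderiv ℝ g) (hg.fderiv_right (m := ∞) le_rfl)

theorem extDeriv_comp_add {E : Type*} [NormedAddCommGroup E] [NormedSpace ℝ E] {k : ℕ}
    (g : E → E [⋀^Fin k]→L[ℝ] ℝ) (a v : E) :
    extDeriv (fun w => g (a + w)) v = extDeriv g (a + v) := by
  rw [extDeriv, extDeriv, fderiv_comp_add_left]

theorem isSmoothForm_extDerivForm {k : ℕ} {T : K}
    {u : carrier R T → (dir R T) [⋀^Fin k]→L[ℝ] ℝ}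
    (hu : IsSmoothForm R T u) : IsSmoothForm R T (extDerivForm R T u) := by
  obtain ⟨θ, h1, h2⟩ := hu
  obtain ⟨j⟩ := nonempty_simplex T
  have hj : R.point T j ∈ span R T := subset_affineSpan ℝ _ ⟨j, rfl⟩
  obtain ⟨P, hP⟩ := Submodule.ClosedComplemented.of_finiteDimensional (dir R T)
  have hg := contDiff_chart R h1 hj
  refine ⟨fun y => extDeriv (fun v : dir R T => θ (R.point T j + v)) (P (y - R.point T j)),
    ((contDiff_extDeriv hg).comp
      (P.contDiff.comp (contDiff_id.sub contDiff_const))).contDiffOn, fun x => ?_⟩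
  have hx := carrier_subset_span R T x.2
  rw [extDerivForm_eq R h2 x ((contDiff_chart R h1 hx).differentiable (by simp) 0)]
  have h3 : P ((x : V T) - R.point T j) = ⟨x - R.point T j, sub_mem_dir R hj hx⟩ :=
    hP ⟨x - R.point T j, sub_mem_dir R hj hx⟩
  beta_reduce
  rw [h3]
  have h4 := extDeriv_comp_add (fun v : dir R T => θ (R.point T j + v))
    ⟨x - R.point T j, sub_mem_dir R hj hx⟩ 0
  rw [add_zero] at h4
  rw [← h4]
  congr 1
  funext v
  congr 1
  simp only [Submodule.coe_add]
  abel

theorem pullback_extDerivForm {k : ℕ} {T' T : K} (h : T'.1 ⊆ T.1)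
    {u : carrier R T → (dir R T) [⋀^Fin k]→L[ℝ] ℝ} (hu : IsSmoothForm R T u) :
    pullback R h (extDerivForm R T u) = extDerivForm R T' (pullback R h u) := by
  obtain ⟨θ, h1, h2⟩ := hu
  funext x
  have hx := carrier_subset_span R T (incl_mem_carrier R h x.2)
  have hg : ContDiff ℝ ∞ (fun v : dir R T => θ (incl R h x + v)) := contDiff_chart R h1 hx
  have hgd := hg.differentiable (by simp)
  have hL : ∀ v : dir R T', incl R h ((x : V T') + v) = incl R h x + (inclDir R h v : V T) := by
    intro v
    have := (incl R h).map_vadd (x : V T') (v : V T')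
    rw [vadd_eq_add, vadd_eq_add, add_comm] at this
    rw [this, add_comm, coe_inclDir]
  have hfun : (fun v : dir R T' => (θ (incl R h ((x : V T') + v))).compContinuousLinearMap
      (inclDir R h)) = fun v : dir R T' => ((fun w : dir R T => θ (incl R h x + w))
        (inclDir R h v)).compContinuousLinearMap (fderiv ℝ (inclDir R h) v) := by
    funext v
    rw [hL, (inclDir R h).fderiv]
  have hdiff : DifferentiableAt ℝ (fun v : dir R T' =>
      (θ (incl R h ((x : V T') + v))).compContinuousLinearMap (inclDir R h)) 0 := by
    simp only [hL]
    exact ((ContinuousAlternatingMap.compContinuousLinearMapCLM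
      (inclDir R h)).differentiable.comp (hgd.comp (inclDir R h).differentiable)) 0
  rw [extDerivForm_eq R (θ := fun y => (θ (incl R h y)).compContinuousLinearMap (inclDir R h))
    (fun y => by rw [pullback, ← h2]) x hdiff, hfun,
    extDeriv_pullback (r := ∞) (hgd _) (inclDir R h).contDiff.contDiffAt (by simpa using two_le_infty),
    pullback, extDerivForm_eq R h2 _ (hgd 0), (inclDir R h).fderiv, map_zero]

/-- The exterior derivative `d : Ω^k(K) → Ω^{k+1}(K)`, applied componentwise. -/
def d (k : ℕ) : Omega R k →ₗ[ℝ] Omega R (k + 1) where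
  toFun u := ⟨fun T => extDerivForm R T (u.1 T),
    fun T => isSmoothForm_extDerivForm R (u.2.1 T),
    fun T' T h => by rw [pullback_extDerivForm R h (u.2.1 T), u.2.2 T' T h]⟩
  map_add' u v := by
    apply Subtype.ext
    funext T x
    obtain ⟨θ, h1, h2⟩ := u.2.1 T
    obtain ⟨η, h3, h4⟩ := v.2.1 T
    have hx := carrier_subset_span R T x.2
    have hθ := (contDiff_chart R h1 hx).differentiable (by simp) 0
    have hη := (contDiff_chart R h3 hx).differentiable (by simp) 0
    change extDerivForm R T _ x = extDerivForm R T _ x + extDerivForm R T _ x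
    rw [extDerivForm_eq R h2 x hθ, extDerivForm_eq R h4 x hη, ← extDeriv_fun_add hθ hη]
    exact extDerivForm_eq R (θ := fun y => θ y + η y)
      (fun y => by rw [h2, h4]; rfl) x (hθ.add hη)
  map_smul' c u := by
    apply Subtype.ext
    funext T x
    obtain ⟨θ, h1, h2⟩ := u.2.1 T
    have hx := carrier_subset_span R T x.2
    have hθ := (contDiff_chart R h1 hx).differentiable (by simp) 0
    change extDerivForm R T _ x = c • extDerivForm R T _ x
    rw [extDerivForm_eq R h2 x hθ, ← extDeriv_smul c]
    exact extDerivForm_eq R (θ := fun y => c • θ y)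
      (fun y => by rw [h2]; rfl) x (hθ.const_smul c)

theorem d_d (k : ℕ) (u : Omega R k) : d R (k + 1) (d R k u) = 0 := by
  apply Subtype.ext
  funext T x
  obtain ⟨θ, h1, h2⟩ := u.2.1 T
  have hsp : ∀ y : carrier R T, (y : V T) ∈ span R T := fun y => carrier_subset_span R T y.2
  have key : ∀ v : dir R T, extDeriv (fun w : dir R T => θ ((x : V T) + v + w)) 0
      = extDeriv (fun w : dir R T => θ ((x : V T) + w)) v := by
    intro v
    have := extDeriv_comp_add (fun w : dir R T => θ ((x : V T) + w)) v 0
    rw [add_zero] at this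
    rw [← this]
    congr 1
    funext w
    simp [add_assoc]
  have hg := contDiff_chart R h1 (hsp x)
  change extDerivForm R T (extDerivForm R T (u.1 T)) x = 0
  rw [extDerivForm_eq R (θ := fun y => extDeriv (fun w : dir R T => θ (y + w)) 0)
    (fun y => (extDerivForm_eq R h2 y
      ((contDiff_chart R h1 (hsp y)).differentiable (by simp) 0)).symm) x
    (by simp only [key]; exact (contDiff_extDeriv hg).differentiable (by simp) 0)]
  simp only [key]
  exact congrFun (extDeriv_extDeriv hg (by simpa using two_le_infty)) 0

/-! ### Lowest order finite elements -/

/-- The wedge product `α_1 ∧ ⋯ ∧ α_k` of covectors: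
`(α_1 ∧ ⋯ ∧ α_k) (v_1, …, v_k) = det (α_i (v_j))`. -/
def wedge {E : Type*} [NormedAddCommGroup E] [NormedSpace ℝ E] {k : ℕ} (α : Fin k → E →L[ℝ] ℝ) :
    E [⋀^Fin k]→L[ℝ] ℝ :=
  ({ toAlternatingMap := Matrix.detRowAlternating
     cont := Continuous.matrix_det (A := fun M : Matrix (Fin k) (Fin k) ℝ => M) continuous_id } :
    (Fin k → ℝ) [⋀^Fin k]→L[ℝ] ℝ).compContinuousLinearMap (ContinuousLinearMap.pi α)

theorem wedge_apply {E : Type*} [NormedAddCommGroup E] [NormedSpace ℝ E] {k : ℕ}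
    (α : Fin k → E →L[ℝ] ℝ) (v : Fin k → E) :
    wedge α v = Matrix.det (Matrix.of fun i j => α i (v j)) := by
  rw [← Matrix.det_transpose]
  rfl

open Classical in
/-- The piecewise affine function `λ_i` on `|T|`: it is the barycentric coordinate relative to `i`
if `i` is a vertex of `T`, and it vanishes on `|T|` otherwise. -/
def bary (T : K) (i : ι) : V T →ᵃ[ℝ] ℝ :=
  affineInterp (R.affineIndependent T) fun j => if j.1 = i then 1 else 0

/-- The (constant) differential `dλ_i` on `|T|`. -/
def dbary (T : K) (i : ι) : dir R T →L[ℝ] ℝ :=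
  LinearMap.toContinuousLinearMap ((bary R T i).linear ∘ₗ (dir R T).subtype)

/-- The form `k! ∑ i, (-1)^i λ_{s i} dλ_{s 0} ∧ ⋯ (dλ_{s i})^ ⋯ ∧ dλ_{s k}`, where the factor
`dλ_{s i}` is omitted, for vertices `s 0, …, s k`. -/
def whitneyFamily {k : ℕ} (s : Fin (k + 1) → ι) : FormFamily R k :=
  fun T x => (k.factorial : ℝ) • ∑ i : Fin (k + 1),
    ((-1 : ℝ) ^ (i : ℕ) * bary R T (s i) x) • wedge fun j => dbary R T (s (i.succAbove j))

theorem bary_incl {T' T : K} (h : T'.1 ⊆ T.1) (i : ι) {x : V T'} (hx : x ∈ span R T') :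
    bary R T i (incl R h x) = bary R T' i x := by
  have h1 : Set.EqOn ((bary R T i).comp (incl R h)) (bary R T' i) (Set.range (R.point T')) := by
    rintro _ ⟨j, rfl⟩
    rw [AffineMap.comp_apply, incl_point, bary, bary, affineInterp_apply, affineInterp_apply]
  exact AffineMap.eqOn_affineSpan h1 hx

theorem dbary_inclDir {T' T : K} (h : T'.1 ⊆ T.1) (i : ι) (v : dir R T') :
    dbary R T i (inclDir R h v) = dbary R T' i v := by
  obtain ⟨j⟩ := nonempty_simplex T'
  have hj : R.point T' j ∈ span R T' := subset_affineSpan ℝ _ ⟨j, rfl⟩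
  have e1 := bary_incl R h i hj
  have e2 := bary_incl R h i (add_mem_span R hj v)
  have e3 := (incl R h).map_vadd (R.point T' j) (v : V T')
  have e4 := (bary R T' i).map_vadd (R.point T' j) (v : V T')
  have e5 := (bary R T i).map_vadd (incl R h (R.point T' j)) ((incl R h).linear v)
  simp only [vadd_eq_add] at e3 e4 e5
  rw [add_comm, e3, e5, e4, e1] at e2
  exact add_right_cancel e2

theorem dbary_comp_sub {T : K} (i : ι) (x y : V T) (hx : x ∈ span R T) (hy : y ∈ span R T) :
    bary R T i y = bary R T i x + dbary R T i ⟨y - x, sub_mem_dir R hx hy⟩ := by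
  have := (bary R T i).map_vadd x (y - x)
  simp only [vadd_eq_add, sub_add_cancel] at this
  rw [this, add_comm]
  rfl

theorem whitneyFamily_mem {k : ℕ} (s : Fin (k + 1) → ι) : whitneyFamily R s ∈ Omega R k := by
  refine ⟨fun T => ?_, fun T' T h => ?_⟩
  · refine ⟨fun x => (k.factorial : ℝ) • ∑ i : Fin (k + 1),
      ((-1 : ℝ) ^ (i : ℕ) * bary R T (s i) x) • wedge fun j => dbary R T (s (i.succAbove j)),
      ?_, fun x => rfl⟩
    have hb : ∀ i, ContDiffOn ℝ ∞ (bary R T i) (span R T : Set (V T)) := by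
      intro i
      obtain ⟨j⟩ := nonempty_simplex T
      have hj : R.point T j ∈ span R T := subset_affineSpan ℝ _ ⟨j, rfl⟩
      obtain ⟨P, hP⟩ := Submodule.ClosedComplemented.of_finiteDimensional (dir R T)
      have h1 : ContDiff ℝ ∞ fun y : V T =>
          bary R T i (R.point T j) + dbary R T i (P (y - R.point T j)) :=
        contDiff_const.add ((dbary R T i).contDiff.comp
          (P.contDiff.comp (contDiff_id.sub contDiff_const)))
      refine h1.contDiffOn.congr fun y hy => ?_
      have h2 : P (y - R.point T j) = ⟨y - R.point T j, sub_mem_dir R hj hy⟩ :=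
        hP ⟨y - R.point T j, sub_mem_dir R hj hy⟩
      rw [h2]
      exact dbary_comp_sub R i _ _ hj hy
    exact ContDiffOn.const_smul _ (ContDiffOn.sum fun i _ =>
      (contDiffOn_const.mul (hb _)).smul contDiffOn_const)
  · funext x
    ext v
    simp only [pullback, whitneyFamily, ContinuousAlternatingMap.compContinuousLinearMap_apply,
      ContinuousAlternatingMap.smul_apply, ContinuousAlternatingMap.sum_apply, wedge_apply,
      bary_incl R h _ (carrier_subset_span R T' x.2), Function.comp_apply, dbary_inclDir]

/-- The compatible `k`-form `λ_T` associated with a `k`-simplex `T` whose vertices are ordered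
by `σ`. For `k = 0` it is the function `λ_i` of the vertex `i` of `T`. -/
def whitney (σ : VertexOrdering K) {k : ℕ} (T : K) (hT : T.1.card = k + 1) : Omega R k :=
  ⟨whitneyFamily R fun i => (σ T (Fin.cast hT.symm i)).1, whitneyFamily_mem R _⟩

/-- The space `Λ^k(K)` of lowest order finite elements: the linear span of the forms `λ_T`,
where `T` ranges over the `k`-simplexes. -/
def Lambda (σ : VertexOrdering K) (k : ℕ) : Submodule ℝ (Omega R k) :=
  Submodule.span ℝ {u | ∃ (T : K) (hT : T.1.card = k + 1), u = whitney R σ T hT}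

/-! ### Interpolators and cohomology -/

/-- `P` is a family of interpolation operators onto the spaces `S k`: linear projectors of `Ω^k`
with range `S k`, which commute with the exterior derivative. -/
structure IsInterpolator (S : ∀ k, Submodule ℝ (Omega R k))
    (P : ∀ k, Omega R k →ₗ[ℝ] Omega R k) : Prop where
  isProj : ∀ k, LinearMap.IsProj (S k) (P k)
  comm : ∀ k u, d R k (P k u) = P (k + 1) (d R k u)

/-- Spaces which carry an interpolator form a subcomplex. -/
theorem IsInterpolator.d_mem {S : ∀ k, Submodule ℝ (Omega R k)}
    {P : ∀ k, Omega R k →ₗ[ℝ] Omega R k} (h : IsInterpolator R S P) {k : ℕ} {u : Omega R k}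
    (hu : u ∈ S k) : d R k u ∈ S (k + 1) := by
  rw [← (h.isProj k).map_id u hu, h.comm]
  exact (h.isProj (k + 1)).map_mem _

/-- The kernel of `d : S^k → S^{k+1}`. -/
def cocycles (S : ∀ k, Submodule ℝ (Omega R k)) (k : ℕ) : Submodule ℝ (Omega R k) :=
  S k ⊓ LinearMap.ker (d R k)

/-- The range of `d : S^{k-1} → S^k`, where `S^{-1} = 0`. -/
def coboundaries (S : ∀ k, Submodule ℝ (Omega R k)) : ∀ k, Submodule ℝ (Omega R k)
  | 0 => ⊥
  | k + 1 => (S k).map (d R k)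

theorem coboundaries_le_cocycles {S : ∀ k, Submodule ℝ (Omega R k)}
    (hS : ∀ k, ∀ u ∈ S k, d R k u ∈ S (k + 1)) (k : ℕ) :
    coboundaries R S k ≤ cocycles R S k := by
  cases k with
  | zero => exact bot_le
  | succ k =>
    rintro _ ⟨u, hu, rfl⟩
    exact ⟨hS k u hu, d_d R k u⟩

/-- The cohomology group `H^k S^• = ker (d : S^k → S^{k+1}) / im (d : S^{k-1} → S^k)` of a
subcomplex `S^•` of `Ω^•`. -/
abbrev Cohomology (S : ∀ k, Submodule ℝ (Omega R k)) (k : ℕ) :=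
  cocycles R S k ⧸ (coboundaries R S k).submoduleOf (cocycles R S k)

theorem cocycles_mono {S S' : ∀ k, Submodule ℝ (Omega R k)} (h : ∀ k, S k ≤ S' k) (k : ℕ) :
    cocycles R S k ≤ cocycles R S' k :=
  inf_le_inf_right _ (h k)

theorem coboundaries_mono {S S' : ∀ k, Submodule ℝ (Omega R k)} (h : ∀ k, S k ≤ S' k) (k : ℕ) :
    coboundaries R S k ≤ coboundaries R S' k := by
  cases k with
  | zero => exact le_rfl
  | succ k => exact Submodule.map_mono (h k)

/-- The map `H^k S^• → H^k S'^•` induced by an inclusion of subcomplexes. -/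
def cohomologyMap {S S' : ∀ k, Submodule ℝ (Omega R k)} (h : ∀ k, S k ≤ S' k) (k : ℕ) :
    Cohomology R S k →ₗ[ℝ] Cohomology R S' k :=
  Submodule.mapQ _ _ (Submodule.inclusion (cocycles_mono R h k))
    fun _ hx => coboundaries_mono R h k hx

end Forms

end CompatibleForms

end

/-! Injectivity and surjectivity each use one projector. A projector commuting with `d` sends
coboundaries to coboundaries of its range and fixes that range. If an element of `Λ^k` is a
coboundary in `Γ`, applying the projector onto `Λ` exhibits it as a coboundary in `Λ`. For
surjectivity, a closed `u` in `Γ^k` is written `u = w + b` with `w` a closed element of `Λ^k` and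
`b` exact in `Ω`. The projector onto `Γ` fixes `u` and `w`, so it maps `b` to itself and makes it
exact in `Γ`.

The substance is this decomposition, `mem_Lambda_sup_coboundaries`, a de Rham theorem for compatible
forms proved by induction over skeleta. Suppose `u` has been corrected by an element of `Λ^k +
dΩ^{k-1}` so as to vanish on all simplices with at most `m` vertices. On a simplex `T` with `m + 1`
vertices the remainder vanishes on the boundary. It need not be closed globally, since `λ_T` is not,
but its derivative lies in `Λ^{k+1}`, which forces closedness on `T` (`d_eq_zero_of_mem_Lambda`). By
`exists_relative_primitive` it is then on `T` a multiple of `λ_T` plus an exact form that vanishes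
on every simplex not containing `T`. Subtracting these local corrections clears the next skeleton.

Stokes' theorem would supply `coeff_eq_zero`: `λ_T` is not the derivative of a form vanishing on the
boundary. Here it is replaced by an induction on dimension. Let `F` be the facet opposite a vertex
`i`; on `T`, `dλ_F` is a nonzero multiple of `λ_T` (`exists_facet`). Coning from `i` yields a
primitive vanishing on the faces through `i` where the form vanishes (`exists_primitive`), which
transfers the question from `T` to `F`. `exists_relative_primitive` follows the same scheme.

Passing from one simplex to the whole complex rests on `extendForm`, a sum of pull-backs along
vertex collapses weighted by barycentric coordinates. -/

noncomputable section

namespace CompatibleForms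

/-! ### The Poincaré homotopy -/

section Calculus

universe u

-- Differentiation under the integral sign; the dominating constant comes from compactness of the
-- closed unit ball around `x` times `[0, 1]`.
open MeasureTheory in
theorem hasFDerivAt_intervalIntegral {E F : Type u} [NormedAddCommGroup E] [NormedSpace ℝ E]
    [FiniteDimensional ℝ E] [NormedAddCommGroup F] [NormedSpace ℝ F]
    {G : E × ℝ → F} (hG : ContDiff ℝ 1 G) (x : E) :
    HasFDerivAt (fun x => ∫ t in (0 : ℝ)..1, G (x, t))
      (∫ t in (0 : ℝ)..1, (fderiv ℝ G (x, t)).comp (ContinuousLinearMap.inl ℝ E ℝ)) x := by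
  have hc : Continuous G := hG.continuous
  have hF' : Continuous fun p : E × ℝ =>
      (fderiv ℝ G p).comp (ContinuousLinearMap.inl ℝ E ℝ) :=
    (hG.continuous_fderiv one_ne_zero).clm_comp continuous_const
  have : ProperSpace E := FiniteDimensional.proper ℝ E
  obtain ⟨C, hC⟩ := ((isCompact_closedBall x 1).prod (isCompact_Icc (a := (0 : ℝ)) (b := 1))
    ).exists_bound_of_continuousOn hF'.continuousOn
  refine intervalIntegral.hasFDerivAt_integral_of_dominated_of_fderiv_le (μ := volume)
    (s := Metric.closedBall x 1) (bound := fun _ => C)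
    (F := fun x t => G (x, t))
    (F' := fun x t => (fderiv ℝ G (x, t)).comp (ContinuousLinearMap.inl ℝ E ℝ))
    (Metric.closedBall_mem_nhds x one_pos) ?_ ?_ ?_ ?_ ?_ ?_
  · exact .of_forall fun y => (hc.comp (by fun_prop : Continuous fun t : ℝ => (y, t))
      ).aestronglyMeasurable
  · exact (hc.comp (by fun_prop : Continuous fun t : ℝ => (x, t))).intervalIntegrable _ _
  · exact (hF'.comp (by fun_prop : Continuous fun t : ℝ => (x, t))).aestronglyMeasurable
  · refine .of_forall fun t ht y hy => hC (y, t) ⟨hy, ?_⟩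
    rw [Set.uIoc_of_le zero_le_one] at ht
    exact ⟨ht.1.le, ht.2⟩
  · exact intervalIntegrable_const
  · refine .of_forall fun t _ y _ => ?_
    exact ((hG.differentiable one_ne_zero) (y, t)).hasFDerivAt.comp y
      (hasFDerivAt_prodMk_left y t)

/-- The derivative is an integral of the same shape with values in `E →L[ℝ] F`, so the order of
smoothness can be raised by induction. `E` and `F` share a universe so that this replacement of `F`
is allowed. -/
theorem contDiff_intervalIntegral {E F : Type u} [NormedAddCommGroup E] [NormedSpace ℝ E]
    [FiniteDimensional ℝ E] [NormedAddCommGroup F] [NormedSpace ℝ F]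
    {G : E × ℝ → F} (hG : ContDiff ℝ ∞ G) :
    ContDiff ℝ ∞ fun x => ∫ t in (0 : ℝ)..1, G (x, t) := by
  rw [contDiff_infty]
  intro n
  induction n generalizing F with
  | zero =>
    exact contDiff_zero.2 (continuous_iff_continuousAt.2 fun x =>
      (hasFDerivAt_intervalIntegral (hG.of_le (by simp)) x).continuousAt)
  | succ n ih =>
    have h := hasFDerivAt_intervalIntegral (hG.of_le (m := 1) (by simp))
    push_cast
    refine contDiff_succ_iff_fderiv.2 ⟨fun x => (h x).differentiableAt, by simp, ?_⟩
    rw [funext fun x => (h x).fderiv]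
    exact ih (G := fun p => (fderiv ℝ G p).comp (ContinuousLinearMap.inl ℝ E ℝ))
      ((hG.fderiv_right (m := ∞) le_rfl).clm_comp contDiff_const)

variable {E : Type u} [NormedAddCommGroup E] [NormedSpace ℝ E]

/-- The integrand of the Poincaré homotopy for the contraction of `E` to the origin. -/
def coneIntegrand {k : ℕ} (g : E → E [⋀^Fin (k + 1)]→L[ℝ] ℝ) (p : E × ℝ) :
    E [⋀^Fin k]→L[ℝ] ℝ :=
  p.2 ^ k • (g (p.2 • p.1)).curryLeft p.1

/-- The Poincaré homotopy for the contraction of `E` to the origin. -/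
def coneHomotopy {k : ℕ} (g : E → E [⋀^Fin (k + 1)]→L[ℝ] ℝ) (v : E) : E [⋀^Fin k]→L[ℝ] ℝ :=
  ∫ t in (0 : ℝ)..1, coneIntegrand g (v, t)

theorem contDiff_coneIntegrand {k : ℕ} {g : E → E [⋀^Fin (k + 1)]→L[ℝ] ℝ}
    (hg : ContDiff ℝ ∞ g) : ContDiff ℝ ∞ (coneIntegrand g) := by
  refine (contDiff_snd.pow k).smul (ContDiff.clm_apply ?_ contDiff_fst)
  exact (ContinuousAlternatingMap.curryLeftLI (𝕜 := ℝ) (E := E) (F := ℝ) (n := k)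
    ).contDiff.comp (hg.comp (contDiff_snd.smul contDiff_fst))

/-- Composition with `inl` keeps the partial derivative in the space variable; the extra factor `t`
comes from the chain rule through `t • v`. -/
theorem fderiv_coneIntegrand {k : ℕ} {g : E → E [⋀^Fin (k + 1)]→L[ℝ] ℝ}
    (hg : ContDiff ℝ ∞ g) (v w : E) (t : ℝ) :
    (fderiv ℝ (coneIntegrand g) (v, t)).comp (ContinuousLinearMap.inl ℝ E ℝ) w =
      t ^ (k + 1) • (fderiv ℝ g (t • v) w).curryLeft v + t ^ k • (g (t • v)).curryLeft w := by
  have h1 : HasFDerivAt (fun v => coneIntegrand g (v, t))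
      ((fderiv ℝ (coneIntegrand g) (v, t)).comp (ContinuousLinearMap.inl ℝ E ℝ)) v :=
    HasFDerivAt.comp (g := coneIntegrand g) (f := fun v => (v, t)) v
      (((contDiff_coneIntegrand hg).differentiable (by simp)) (v, t)).hasFDerivAt
      (hasFDerivAt_prodMk_left v t)
  have h2 : HasFDerivAt (fun v : E => g (t • v))
      ((fderiv ℝ g (t • v)).comp (t • ContinuousLinearMap.id ℝ E)) v :=
    (hg.differentiable (by simp) (t • v)).hasFDerivAt.comp v
      ((hasFDerivAt_id v).const_smul t)
  have h3 := (((ContinuousAlternatingMap.curryLeftLI (𝕜 := ℝ) (E := E) (F := ℝ) (n := k)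
    ).toContinuousLinearMap.hasFDerivAt.comp v h2).clm_apply (hasFDerivAt_id v)).const_smul (t ^ k)
  have h4 := congrArg (fun L => L w) (h1.unique h3)
  refine h4.trans ?_
  ext m
  simp
  ring

variable [FiniteDimensional ℝ E]

theorem contDiff_coneHomotopy {k : ℕ} {g : E → E [⋀^Fin (k + 1)]→L[ℝ] ℝ}
    (hg : ContDiff ℝ ∞ g) : ContDiff ℝ ∞ (coneHomotopy g) :=
  contDiff_intervalIntegral (contDiff_coneIntegrand hg)

/-- The Poincaré lemma: a form which is closed along a segment issued from the origin is
there the exterior derivative of its Poincaré homotopy. -/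
theorem extDeriv_coneHomotopy {k : ℕ} {g : E → E [⋀^Fin (k + 1)]→L[ℝ] ℝ}
    (hg : ContDiff ℝ ∞ g) (v : E)
    (hd : ∀ t ∈ Set.Icc (0 : ℝ) 1, extDeriv g (t • v) = 0) :
    extDeriv (coneHomotopy g) v = g v := by
  have hgd := hg.differentiable (by simp)
  have hci := contDiff_coneIntegrand hg
  have hD : ContDiff ℝ ∞ fun p : E × ℝ =>
      (fderiv ℝ (coneIntegrand g) p).comp (ContinuousLinearMap.inl ℝ E ℝ) :=
    (hci.fderiv_right (m := ∞) le_rfl).clm_comp contDiff_const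
  have hDt : Continuous fun t : ℝ =>
      (fderiv ℝ (coneIntegrand g) (v, t)).comp (ContinuousLinearMap.inl ℝ E ℝ) :=
    hD.continuous.comp (by fun_prop : Continuous fun t : ℝ => (v, t))
  have hfd : fderiv ℝ (coneHomotopy g) v = _ :=
    (hasFDerivAt_intervalIntegral (hci.of_le (m := 1) (by simp)) v).fderiv
  rw [extDeriv, hfd,
    ← ContinuousAlternatingMap.alternatizeUncurryFinCLM_apply,
    ← ContinuousLinearMap.intervalIntegral_comp_comm _ (hDt.intervalIntegrable _ _)]
  -- Cartan's formula for the radial field: where `dg = 0`, the alternated integrand is a total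
  -- `t`-derivative.
  have hderiv : ∀ t ∈ Set.uIcc (0 : ℝ) 1, HasDerivAt (fun t : ℝ => t ^ (k + 1) • g (t • v))
      (ContinuousAlternatingMap.alternatizeUncurryFinCLM ℝ E ℝ
        ((fderiv ℝ (coneIntegrand g) (v, t)).comp (ContinuousLinearMap.inl ℝ E ℝ))) t := by
    intro t ht
    rw [Set.uIcc_of_le zero_le_one] at ht
    have h1 : HasDerivAt (fun t : ℝ => g (t • v)) (fderiv ℝ g (t • v) v) t := by
      have := HasFDerivAt.comp_hasDerivAt (f := fun t : ℝ => t • v) t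
        (hgd (t • v)).hasFDerivAt ((hasDerivAt_id t).smul_const v)
      rw [one_smul] at this
      exact this
    refine ((hasDerivAt_pow (k + 1) t).smul h1).congr_deriv ?_
    ext m
    -- Closedness evaluated on `(v, m)` expresses the derivative of `g` along `v` through the terms
    -- in which `v` is an argument of the form.
    have hdm := congrArg (fun f => f (Matrix.vecCons v m)) (hd t ht)
    rw [ContinuousAlternatingMap.alternatizeUncurryFinCLM_apply,
      ContinuousAlternatingMap.alternatizeUncurryFin_apply]
    simp only [extDeriv, ContinuousAlternatingMap.alternatizeUncurryFin_apply] at hdm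
    rw [Fin.sum_univ_succ] at hdm
    -- Alternating the contraction of a `(k+1)`-form gives back `k + 1` times the form, matching the
    -- derivative of `t ^ (k + 1)`.
    have hcl := congrArg (fun f => f m)
      (ContinuousAlternatingMap.alternatizeUncurryFin_curryLeft (g (t • v)))
    simp only [ContinuousAlternatingMap.alternatizeUncurryFin_apply] at hcl
    simp only [fderiv_coneIntegrand hg, ContinuousAlternatingMap.add_apply, smul_add,
      Finset.sum_add_distrib, ContinuousAlternatingMap.smul_apply]
    simp only [smul_comm _ (t ^ k), smul_comm _ (t ^ (k + 1)), ← Finset.smul_sum, hcl]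
    have hrem : ∀ i : Fin (k + 1), Fin.removeNth i.succ (Matrix.vecCons v m)
        = Matrix.vecCons v (Fin.removeNth i m) := by
      intro i
      ext j
      refine Fin.cases ?_ (fun j => ?_) j <;>
        simp [Fin.removeNth, Fin.succ_succAbove_succ]
    have h0 : Fin.removeNth 0 (Matrix.vecCons v m) = m := by
      ext j; rfl
    simp only [h0, hrem, Fin.val_zero, pow_zero, one_smul, Matrix.cons_val_zero,
      Matrix.cons_val_succ, Fin.val_succ, pow_succ, mul_neg, mul_one, neg_smul,
      Finset.sum_neg_distrib] at hdm
    simp only [ContinuousAlternatingMap.curryLeft_apply_apply,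
      ContinuousAlternatingMap.smul_apply, smul_eq_mul] at hdm ⊢
    rw [← sub_eq_add_neg] at hdm
    rw [← sub_eq_zero.1 (hdm.trans rfl), Nat.add_sub_cancel, nsmul_eq_mul]
    push_cast
    ring
  rw [intervalIntegral.integral_eq_sub_of_hasDerivAt hderiv
    (((ContinuousLinearMap.continuous _).comp hDt).intervalIntegrable _ _)]
  simp

end Calculus

/-! ### Pull-back along vertex maps and extension of forms -/

section VertexMaps

variable {ι : Type*} {K : PreAbstractSimplicialComplex ι} {V : K → Type*}
  [∀ T, NormedAddCommGroup (V T)] [∀ T, NormedSpace ℝ (V T)] (R : AffineRealization K V)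

theorem point_mem_carrier {T : K} (j : T.1) : R.point T j ∈ carrier R T :=
  subset_convexHull ℝ _ ⟨j, rfl⟩

theorem point_mem_span {T : K} (j : T.1) : R.point T j ∈ span R T :=
  subset_affineSpan ℝ _ ⟨j, rfl⟩

theorem eq_on_span {F : Type*} [AddCommGroup F] [Module ℝ F] {T : K} {φ ψ : V T →ᵃ[ℝ] F}
    (h : ∀ j, φ (R.point T j) = ψ (R.point T j)) {x : V T} (hx : x ∈ span R T) : φ x = ψ x := by
  refine AffineMap.eqOn_affineSpan (s := Set.range (R.point T)) ?_ hx
  rintro _ ⟨j, rfl⟩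
  exact h j

theorem linear_eq_on_dir {F : Type*} [AddCommGroup F] [Module ℝ F] {T : K} {φ ψ : V T →ᵃ[ℝ] F}
    (h : ∀ j, φ (R.point T j) = ψ (R.point T j)) {v : V T} (hv : v ∈ dir R T) :
    φ.linear v = ψ.linear v := by
  refine LinearMap.eqOn_span (s := Set.range (R.point T) -ᵥ Set.range (R.point T)) ?_ hv
  rintro _ ⟨_, ⟨a, rfl⟩, _, ⟨b, rfl⟩, rfl⟩
  simp only [AffineMap.linearMap_vsub, h]

/-- `V T` may be infinite-dimensional and `φ` discontinuous. On the span, `φ` agrees with its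
composite with a continuous projection onto the finite-dimensional space of directions. -/
theorem contDiffOn_affineMap {F : Type*} [NormedAddCommGroup F] [NormedSpace ℝ F] {T : K}
    (φ : V T →ᵃ[ℝ] F) : ContDiffOn ℝ ∞ φ (span R T : Set (V T)) := by
  obtain ⟨j⟩ := nonempty_simplex T
  obtain ⟨P, hP⟩ := Submodule.ClosedComplemented.of_finiteDimensional (dir R T)
  have h1 : ContDiff ℝ ∞ fun y : V T => φ (R.point T j) +
      LinearMap.toContinuousLinearMap (φ.linear ∘ₗ (dir R T).subtype) (P (y - R.point T j)) :=
    contDiff_const.add ((ContinuousLinearMap.contDiff _).comp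
      (P.contDiff.comp (contDiff_id.sub contDiff_const)))
  refine h1.contDiffOn.congr fun y hy => ?_
  have h2 : P (y - R.point T j) = ⟨y - R.point T j, sub_mem_dir R (point_mem_span R j) hy⟩ :=
    hP ⟨y - R.point T j, sub_mem_dir R (point_mem_span R j) hy⟩
  rw [h2]
  have := φ.map_vadd (R.point T j) (y - R.point T j)
  simp only [vadd_eq_add, sub_add_cancel] at this
  rw [this, add_comm]
  rfl

/-- The affine map `|S| → |T|` induced by a map of vertices. -/
def vmap {S T : K} (f : S.1 → T.1) : V S →ᵃ[ℝ] V T :=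
  affineInterp (R.affineIndependent S) fun j => R.point T (f j)

theorem vmap_point {S T : K} (f : S.1 → T.1) (j : S.1) :
    vmap R f (R.point S j) = R.point T (f j) :=
  affineInterp_apply _ _ j

theorem vmap_mem_carrier {S T : K} (f : S.1 → T.1) {x : V S} (hx : x ∈ carrier R S) :
    vmap R f x ∈ carrier R T := by
  have h1 : vmap R f x ∈ vmap R f '' carrier R S := ⟨x, hx, rfl⟩
  rw [carrier, AffineMap.image_convexHull, ← Set.range_comp] at h1
  refine convexHull_mono ?_ h1
  rintro _ ⟨j, rfl⟩
  exact ⟨f j, (vmap_point R f j).symm⟩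

theorem vmap_mem_span {S T : K} (f : S.1 → T.1) {x : V S} (hx : x ∈ span R S) :
    vmap R f x ∈ span R T := by
  have h1 : vmap R f x ∈ (span R S).map (vmap R f) := ⟨x, hx, rfl⟩
  rw [span, AffineSubspace.map_span, ← Set.range_comp] at h1
  refine affineSpan_mono ℝ ?_ h1
  rintro _ ⟨j, rfl⟩
  exact ⟨f j, (vmap_point R f j).symm⟩

theorem vmap_linear_mem_dir {S T : K} (f : S.1 → T.1) (v : V S) (hv : v ∈ dir R S) :
    (vmap R f).linear v ∈ dir R T := by
  have h1 : (vmap R f).linear v ∈ (dir R S).map (vmap R f).linear := ⟨v, hv, rfl⟩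
  rw [dir, AffineMap.map_vectorSpan, ← Set.range_comp] at h1
  refine vectorSpan_mono ℝ ?_ h1
  rintro _ ⟨j, rfl⟩
  exact ⟨f j, (vmap_point R f j).symm⟩

/-- The differential of the affine map induced by a map of vertices. -/
def vmapDir {S T : K} (f : S.1 → T.1) : dir R S →L[ℝ] dir R T :=
  LinearMap.toContinuousLinearMap ((vmap R f).linear.restrict (vmap_linear_mem_dir R f))

/-- Functoriality is asserted on the span only: off it, `affineInterp` is an arbitrary choice. -/
theorem vmap_comp {S T U : K} (g : T.1 → U.1) (f : S.1 → T.1) {x : V S} (hx : x ∈ span R S) :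
    vmap R g (vmap R f x) = vmap R (g ∘ f) x :=
  eq_on_span R (φ := (vmap R g).comp (vmap R f))
    (fun j => by simp only [AffineMap.comp_apply, vmap_point, Function.comp_apply]) hx

theorem vmapDir_comp {S T U : K} (g : T.1 → U.1) (f : S.1 → T.1) (v : dir R S) :
    vmapDir R g (vmapDir R f v) = vmapDir R (g ∘ f) v :=
  Subtype.ext <| linear_eq_on_dir R (φ := (vmap R g).comp (vmap R f))
    (fun j => by simp only [AffineMap.comp_apply, vmap_point, Function.comp_apply]) v.2

theorem vmap_id {T : K} {x : V T} (hx : x ∈ span R T) : vmap R (id : T.1 → T.1) x = x :=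
  eq_on_span R (ψ := AffineMap.id ℝ (V T)) (fun j => vmap_point R _ j) hx

theorem vmapDir_id {T : K} (v : dir R T) : vmapDir R (id : T.1 → T.1) v = v :=
  Subtype.ext <| linear_eq_on_dir R (ψ := AffineMap.id ℝ (V T)) (fun j => vmap_point R _ j) v.2

variable {k : ℕ}

/-- The pull-back of a `k`-form along a map of vertices. -/
def vpull {S T : K} (f : S.1 → T.1) (y : carrier R T → (dir R T) [⋀^Fin k]→L[ℝ] ℝ) :
    carrier R S → (dir R S) [⋀^Fin k]→L[ℝ] ℝ :=
  fun x => (y ⟨vmap R f x, vmap_mem_carrier R f x.2⟩).compContinuousLinearMap (vmapDir R f)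

/-- Restriction to a face becomes a pull-back along a vertex map, so it can be composed with
collapses by `vpull_vpull`. -/
theorem pullback_eq_vpull {S T : K} (h : S.1 ⊆ T.1)
    (y : carrier R T → (dir R T) [⋀^Fin k]→L[ℝ] ℝ) :
    pullback R h y = vpull R (fun j : S.1 => (⟨j.1, h j.2⟩ : T.1)) y := rfl

theorem vpull_vpull {S T U : K} (g : T.1 → U.1) (f : S.1 → T.1)
    (y : carrier R U → (dir R U) [⋀^Fin k]→L[ℝ] ℝ) :
    vpull R f (vpull R g y) = vpull R (g ∘ f) y := by
  funext x
  ext v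
  have h1 : (⟨vmap R g (vmap R f x), vmap_mem_carrier R g (vmap_mem_carrier R f x.2)⟩ :
      carrier R U) = ⟨vmap R (g ∘ f) x, vmap_mem_carrier R _ x.2⟩ :=
    Subtype.ext (vmap_comp R g f (carrier_subset_span R S x.2))
  simp only [vpull, ContinuousAlternatingMap.compContinuousLinearMap_apply]
  rw [h1]
  congr 1
  funext i
  exact vmapDir_comp R g f (v i)

theorem vpull_id {T : K} (y : carrier R T → (dir R T) [⋀^Fin k]→L[ℝ] ℝ) :
    vpull R (id : T.1 → T.1) y = y := by
  funext x
  ext v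
  have h1 : (⟨vmap R (id : T.1 → T.1) x, vmap_mem_carrier R _ x.2⟩ : carrier R T) = x :=
    Subtype.ext (vmap_id R (carrier_subset_span R T x.2))
  simp only [vpull, ContinuousAlternatingMap.compContinuousLinearMap_apply]
  rw [h1]
  congr 1
  funext i
  exact vmapDir_id R (v i)

theorem vpull_zero {S T : K} (f : S.1 → T.1) :
    vpull R f (0 : carrier R T → (dir R T) [⋀^Fin k]→L[ℝ] ℝ) = 0 := rfl

theorem isSmoothForm_vpull {S T : K} (f : S.1 → T.1)
    {y : carrier R T → (dir R T) [⋀^Fin k]→L[ℝ] ℝ} (hy : IsSmoothForm R T y) :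
    IsSmoothForm R S (vpull R f y) := by
  obtain ⟨θ, h1, h2⟩ := hy
  refine ⟨fun x => (θ (vmap R f x)).compContinuousLinearMap (vmapDir R f), ?_, fun x => ?_⟩
  · exact (ContinuousAlternatingMap.compContinuousLinearMapCLM (vmapDir R f)).contDiff.comp_contDiffOn
      (h1.comp (contDiffOn_affineMap R _) fun x hx => vmap_mem_span R f hx)
  · rw [vpull, ← h2]

theorem isSmoothForm_add {T : K} {y z : carrier R T → (dir R T) [⋀^Fin k]→L[ℝ] ℝ}
    (hy : IsSmoothForm R T y) (hz : IsSmoothForm R T z) : IsSmoothForm R T (y + z) := by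
  obtain ⟨θ, h1, h2⟩ := hy
  obtain ⟨η, h3, h4⟩ := hz
  exact ⟨fun x => θ x + η x, h1.add h3, fun x => by simp [h2, h4]⟩

theorem isSmoothForm_sum {T : K} {J : Type*} (s : Finset J)
    {y : J → carrier R T → (dir R T) [⋀^Fin k]→L[ℝ] ℝ} (hy : ∀ j ∈ s, IsSmoothForm R T (y j)) :
    IsSmoothForm R T (∑ j ∈ s, y j) := by
  classical
  exact Finset.sum_induction _ _ (fun _ _ => isSmoothForm_add R)
    ⟨fun _ => 0, contDiffOn_const, fun x => rfl⟩ hy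

theorem isSmoothForm_affineMap_smul {T : K} (φ : V T →ᵃ[ℝ] ℝ)
    {y : carrier R T → (dir R T) [⋀^Fin k]→L[ℝ] ℝ} (hy : IsSmoothForm R T y) :
    IsSmoothForm R T fun x => φ x • y x := by
  obtain ⟨θ, h1, h2⟩ := hy
  exact ⟨fun x => φ x • θ x, (contDiffOn_affineMap R φ).smul h1, fun x => by simp only [h2]⟩

/-! ### Barycentric coordinates -/

open Classical in
theorem bary_point {T : K} (i : ι) (j : T.1) :
    bary R T i (R.point T j) = if j.1 = i then 1 else 0 :=
  affineInterp_apply _ _ j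

theorem bary_eq_zero {T : K} {i : ι} (hi : i ∉ T.1) {x : V T} (hx : x ∈ span R T) :
    bary R T i x = 0 := by
  refine eq_on_span R (ψ := AffineMap.const ℝ (V T) 0) (fun j => ?_) hx
  rw [bary_point, if_neg (fun h : j.1 = i => hi (h ▸ j.2)), AffineMap.const_apply]

theorem dbary_eq_zero {T : K} {i : ι} (hi : i ∉ T.1) : dbary R T i = 0 := by
  ext v
  refine linear_eq_on_dir R (φ := bary R T i) (ψ := AffineMap.const ℝ (V T) 0) (fun j => ?_) v.2
  rw [bary_point, if_neg (fun h : j.1 = i => hi (h ▸ j.2)), AffineMap.const_apply]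

theorem affineMap_sum_apply {E F J : Type*} [AddCommGroup E] [Module ℝ E] [AddCommGroup F]
    [Module ℝ F] (s : Finset J) (φ : J → E →ᵃ[ℝ] F) (x : E) :
    (∑ i ∈ s, φ i) x = ∑ i ∈ s, φ i x :=
  map_sum (⟨⟨fun φ => φ x, rfl⟩, fun _ _ => rfl⟩ : (E →ᵃ[ℝ] F) →+ F) φ s

theorem affineMap_sum_linear_apply {E F J : Type*} [AddCommGroup E] [Module ℝ E]
    [AddCommGroup F] [Module ℝ F] (s : Finset J) (φ : J → E →ᵃ[ℝ] F) (v : E) :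
    (∑ i ∈ s, φ i).linear v = ∑ i ∈ s, (φ i).linear v :=
  map_sum (⟨⟨fun φ => φ.linear v, rfl⟩, fun _ _ => rfl⟩ : (E →ᵃ[ℝ] F) →+ F) φ s

theorem sum_bary_point {T : K} (j : T.1) :
    (∑ i : T.1, bary R T i) (R.point T j) = 1 := by
  classical
  rw [affineMap_sum_apply]
  simp [bary_point]

theorem sum_bary {T : K} {x : V T} (hx : x ∈ span R T) : ∑ i : T.1, bary R T i x = 1 := by
  rw [← affineMap_sum_apply]
  exact eq_on_span R (φ := ∑ i : T.1, bary R T i) (ψ := AffineMap.const ℝ (V T) 1)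
    (fun j => sum_bary_point R j) hx

theorem sum_dbary {T : K} (v : dir R T) : ∑ i : T.1, dbary R T i v = 0 := by
  refine (affineMap_sum_linear_apply Finset.univ (fun i : T.1 => bary R T i) v.1).symm.trans ?_
  exact linear_eq_on_dir R (φ := ∑ i : T.1, bary R T i) (ψ := AffineMap.const ℝ (V T) 1)
    (fun j => sum_bary_point R j) v.2

/-! ### Extension of a form from one simplex to the complex -/

open Classical in
/-- The vertex map `S → T` fixing the common vertices and sending all others to `j`. -/
def collapse (S T : K) (j : T.1) : S.1 → T.1 :=
  fun s => if h : s.1 ∈ T.1 then ⟨s.1, h⟩ else j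

/-- An extension to all simplices of a form given on the simplex `T`. -/
def extendForm (T : K) (y : carrier R T → (dir R T) [⋀^Fin k]→L[ℝ] ℝ) : FormFamily R k :=
  fun S => ∑ j : T.1, fun x => bary R S j x • vpull R (collapse S T j) y x

theorem extendForm_apply (T : K) (y : carrier R T → (dir R T) [⋀^Fin k]→L[ℝ] ℝ) (S : K)
    (x : carrier R S) :
    extendForm R T y S x = ∑ j : T.1, bary R S j x • vpull R (collapse S T j) y x := by
  simp [extendForm]

/-- Both ingredients are compatible with faces: barycentric coordinates by `bary_incl`, and
collapses because restricting the collapse of `S` to a face `S'` gives the collapse of `S'`. -/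
theorem extendForm_mem {T : K} {y : carrier R T → (dir R T) [⋀^Fin k]→L[ℝ] ℝ}
    (hy : IsSmoothForm R T y) : extendForm R T y ∈ Omega R k := by
  refine ⟨fun S => isSmoothForm_sum R _ fun j _ =>
    isSmoothForm_affineMap_smul R _ (isSmoothForm_vpull R _ hy), fun S' S h => ?_⟩
  funext x
  have hc : ∀ j, vpull R (collapse S' T j) y x
      = pullback R h (vpull R (collapse S T j) y) x := by
    intro j
    rw [pullback_eq_vpull, vpull_vpull]
    rfl
  rw [extendForm_apply]
  simp only [hc, ← bary_incl R h _ (carrier_subset_span R S' x.2)]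
  ext v
  simp [pullback, extendForm_apply]

theorem extendForm_self (T : K) (y : carrier R T → (dir R T) [⋀^Fin k]→L[ℝ] ℝ) :
    extendForm R T y T = y := by
  funext x
  have hc : ∀ j, collapse T T j = id := fun j => by
    funext s; exact dif_pos s.2
  simp only [extendForm_apply, hc, vpull_id]
  rw [← Finset.sum_smul, sum_bary R (carrier_subset_span R T x.2), one_smul]

theorem exists_inter_simplex {S T : K} {j : ι} (hS : j ∈ S.1) (hT : j ∈ T.1) :
    ∃ G : K, ∀ i, i ∈ G.1 ↔ i ∈ S.1 ∧ i ∈ T.1 := by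
  classical
  refine ⟨⟨S.1 ∩ T.1, ?_⟩, fun i => Finset.mem_inter⟩
  exact (K.isRelLowerSet_faces S.2).2 Finset.inter_subset_left
    ⟨j, Finset.mem_inter.2 ⟨hS, hT⟩⟩

/-- If `j` is a vertex of `S`, the collapse onto `T` factors through the proper face `S ∩ T`, where
`y` vanishes; otherwise the weight `λ_j` vanishes on `S`. -/
theorem extendForm_eq_zero {T : K} {y : carrier R T → (dir R T) [⋀^Fin k]→L[ℝ] ℝ}
    (hy : ∀ (S : K) (h : S.1 ⊆ T.1), S ≠ T → pullback R h y = 0) {S : K} (hS : ¬ T.1 ⊆ S.1) :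
    extendForm R T y S = 0 := by
  funext x
  rw [extendForm_apply]
  refine Finset.sum_eq_zero fun j _ => ?_
  by_cases hj : j.1 ∈ S.1
  · obtain ⟨G, hG⟩ := exists_inter_simplex hj j.2
    have hGT : G.1 ⊆ T.1 := fun i hi => ((hG i).1 hi).2
    have hGS : G.1 ⊆ S.1 := fun i hi => ((hG i).1 hi).1
    have hfac : collapse S T j
        = (fun s : G.1 => (⟨s.1, hGT s.2⟩ : T.1)) ∘ collapse S G ⟨j.1, (hG j).2 ⟨hj, j.2⟩⟩ := by
      funext s
      by_cases hs : s.1 ∈ T.1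
      · simp [collapse, hs, (hG s.1).2 ⟨s.2, hs⟩]
      · simp [collapse, hs, hG]
    rw [hfac, ← vpull_vpull, ← pullback_eq_vpull R hGT, hy G hGT (fun h => hS (h ▸ hGS)),
      vpull_zero]
    simp
  · rw [bary_eq_zero R hj (carrier_subset_span R S x.2), zero_smul]

end VertexMaps

/-! ### The Poincaré lemma on a simplex -/

section Poincare

variable {ι : Type*} {K : PreAbstractSimplicialComplex ι} {V : K → Type*}
  [∀ T, NormedAddCommGroup (V T)] [∀ T, NormedSpace ℝ (V T)] (R : AffineRealization K V) {k : ℕ}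

/-- The chart is centred at a vertex so that contraction to the origin becomes the cone contraction
of `|T|` to that vertex. -/
theorem exists_chart {T : K} (i : T.1) {y : carrier R T → (dir R T) [⋀^Fin k]→L[ℝ] ℝ}
    (hy : IsSmoothForm R T y) :
    ∃ g : dir R T → (dir R T) [⋀^Fin k]→L[ℝ] ℝ, ContDiff ℝ ∞ g ∧
      ∀ (v : dir R T) (h : R.point T i + (v : V T) ∈ carrier R T), y ⟨_, h⟩ = g v ∧
        extDerivForm R T y ⟨_, h⟩ = extDeriv g v := by
  obtain ⟨θ, h1, h2⟩ := hy
  refine ⟨fun v => θ (R.point T i + v), contDiff_chart R h1 (point_mem_span R i),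
    fun v h => ⟨(h2 _).symm, ?_⟩⟩
  rw [extDerivForm_eq R h2 _ ((contDiff_chart R h1 (carrier_subset_span R T h)).differentiable
    (by simp) 0)]
  have h4 := extDeriv_comp_add (fun v : dir R T => θ (R.point T i + v)) v 0
  rw [add_zero] at h4
  rw [← h4]
  congr 1
  funext w
  simp only [Submodule.coe_add, add_assoc]

theorem exists_form_of_chart {T : K} (i : T.1) {g : dir R T → (dir R T) [⋀^Fin k]→L[ℝ] ℝ}
    (hg : ContDiff ℝ ∞ g) :
    ∃ y : carrier R T → (dir R T) [⋀^Fin k]→L[ℝ] ℝ, IsSmoothForm R T y ∧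
      ∀ (v : dir R T) (h : R.point T i + (v : V T) ∈ carrier R T), y ⟨_, h⟩ = g v ∧
        extDerivForm R T y ⟨_, h⟩ = extDeriv g v := by
  obtain ⟨P, hP⟩ := Submodule.ClosedComplemented.of_finiteDimensional (dir R T)
  have hθ : ContDiff ℝ ∞ fun x : V T => g (P (x - R.point T i)) :=
    hg.comp (P.contDiff.comp (contDiff_id.sub contDiff_const))
  have hv : ∀ v : dir R T, P (R.point T i + (v : V T) - R.point T i) = v := fun v => by
    rw [add_sub_cancel_left, hP]
  refine ⟨fun x => g (P (x - R.point T i)), ⟨_, hθ.contDiffOn, fun x => rfl⟩,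
    fun v h => ⟨by simp only [hv], ?_⟩⟩
  have hfun : (fun w : dir R T => g (P (R.point T i + (v : V T) + w - R.point T i)))
      = fun w => g (v + w) := by
    funext w
    rw [add_assoc, ← Submodule.coe_add, hv]
  rw [extDerivForm_eq R (θ := fun x => g (P (x - R.point T i))) (fun _ => rfl), hfun,
    extDeriv_comp_add, add_zero]
  exact (hθ.comp (contDiff_const.add (dir R T).subtypeL.contDiff)).differentiable (by simp) 0

theorem exists_eq_point_add {T : K} (i : T.1) (x : carrier R T) :
    ∃ (v : dir R T) (h : R.point T i + (v : V T) ∈ carrier R T), x = ⟨_, h⟩ := by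
  have h : R.point T i + (x - R.point T i : V T) = x := by abel
  exact ⟨⟨x - R.point T i, sub_mem_dir R (point_mem_span R i) (carrier_subset_span R T x.2)⟩,
    by simp only [h]; exact x.2, Subtype.ext h.symm⟩

theorem point_add_smul_mem {T : K} (i : T.1) {v : dir R T}
    (h : R.point T i + (v : V T) ∈ carrier R T) {t : ℝ} (ht : t ∈ Set.Icc (0 : ℝ) 1) :
    R.point T i + ((t • v : dir R T) : V T) ∈ carrier R T :=
  (convex_convexHull ℝ _).add_smul_mem (point_mem_carrier R i) h ht

theorem incl_point_add {S T : K} (hST : S.1 ⊆ T.1) (i : S.1) (w : dir R S) :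
    incl R hST (R.point S i + (w : V S))
      = R.point T ⟨i.1, hST i.2⟩ + (inclDir R hST w : V T) := by
  have := (incl R hST).map_vadd (R.point S i) (w : V S)
  rw [vadd_eq_add, vadd_eq_add, add_comm] at this
  rw [this, add_comm, coe_inclDir, incl_point]

variable {R} in
theorem Omega.pullback_eq (u : Omega R k) {S T : K} (h : S.1 ⊆ T.1) :
    pullback R h (u.1 T) = u.1 S := u.2.2 S T h

variable {R} in
/-- A compatible form which is closed on `T` has a primitive on `T`, which vanishes on the faces
containing a given vertex when the form does. -/
theorem exists_primitive (u : Omega R (k + 1)) (T : K) (i : T.1)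
    (hu : (d R (k + 1) u).1 T = 0) :
    ∃ v : Omega R k, (d R k v).1 T = u.1 T ∧
      ∀ S : K, S.1 ⊆ T.1 → i.1 ∈ S.1 → u.1 S = 0 → v.1 S = 0 := by
  obtain ⟨g, hg, hgu⟩ := exists_chart R i (u.2.1 T)
  obtain ⟨y, hy, hgy⟩ := exists_form_of_chart R i (contDiff_coneHomotopy hg)
  refine ⟨⟨extendForm R T y, extendForm_mem R hy⟩, ?_, fun S hS hi hu0 => ?_⟩
  · change extDerivForm R T (extendForm R T y T) = u.1 T
    rw [extendForm_self]
    funext x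
    obtain ⟨v, hv, rfl⟩ := exists_eq_point_add R i x
    rw [(hgy v hv).2, (hgu v hv).1]
    refine extDeriv_coneHomotopy hg v fun t ht => ?_
    rw [← (hgu _ (point_add_smul_mem R i hv ht)).2]
    exact congrFun hu _
  · rw [← Omega.pullback_eq _ hS]
    change pullback R hS (extendForm R T y T) = 0
    rw [extendForm_self]
    funext x
    obtain ⟨w, hw, rfl⟩ := exists_eq_point_add R ⟨i.1, hi⟩ x
    -- In charts centred at the common vertex `i`, the inclusion of the face is the linear map
    -- `inclDir`.
    have hpull : ∀ (w : dir R S) (hw : R.point S ⟨i.1, hi⟩ + (w : V S) ∈ carrier R S) {n : ℕ}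
        (z : carrier R T → (dir R T) [⋀^Fin n]→L[ℝ] ℝ)
        (f : dir R T → (dir R T) [⋀^Fin n]→L[ℝ] ℝ)
        (_ : ∀ (v : dir R T) (h : R.point T i + (v : V T) ∈ carrier R T), z ⟨_, h⟩ = f v),
        pullback R hS z ⟨_, hw⟩
          = (f (inclDir R hS w)).compContinuousLinearMap (inclDir R hS) := by
      intro w hw n z f hzf
      have e := incl_point_add R hS ⟨i.1, hi⟩ w
      have hm := incl_mem_carrier R hS hw
      rw [← hzf _ (e ▸ hm)]
      simp only [pullback, e]
    rw [hpull w hw y (coneHomotopy g) fun v h => (hgy v h).1,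
      ← ContinuousAlternatingMap.compContinuousLinearMapCLM_apply, coneHomotopy,
      ← ContinuousLinearMap.intervalIntegral_comp_comm]
    · have h0 : ∀ t ∈ Set.uIcc (0 : ℝ) 1,
          ContinuousAlternatingMap.compContinuousLinearMapCLM (inclDir R hS)
            (coneIntegrand g (inclDir R hS w, t)) = 0 := by
        intro t ht
        rw [Set.uIcc_of_le zero_le_one] at ht
        have h1 := point_add_smul_mem R ⟨i.1, hi⟩ hw ht
        have h2 := hpull _ h1 (u.1 T) g fun v h => (hgu v h).1
        rw [Omega.pullback_eq, hu0, map_smul] at h2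
        rw [ContinuousAlternatingMap.compContinuousLinearMapCLM_apply, coneIntegrand]
        ext m
        have h3 := congrArg (fun f => f.curryLeft w m) h2.symm
        rw [ContinuousAlternatingMap.curryLeft_compContinuousLinearMap] at h3
        rw [ContinuousAlternatingMap.compContinuousLinearMap_apply,
          ContinuousAlternatingMap.smul_apply,
          ← ContinuousAlternatingMap.compContinuousLinearMap_apply, h3]
        simp
      rw [intervalIntegral.integral_congr h0]
      simp
    · exact ((contDiff_coneIntegrand hg).continuous.comp
        (by fun_prop : Continuous fun t : ℝ => (inclDir R hS w, t))).intervalIntegrable _ _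

variable {R} in
/-- A function which is closed on `T` and vanishes on a face of `T` vanishes on `T`. -/
theorem eq_zero_of_closed (u : Omega R 0) {S T : K} (hS : S.1 ⊆ T.1)
    (hu : (d R 0 u).1 T = 0) (hu0 : u.1 S = 0) : u.1 T = 0 := by
  obtain ⟨i⟩ := nonempty_simplex S
  obtain ⟨g, hg, hgu⟩ := exists_chart R ⟨i.1, hS i.2⟩ (u.2.1 T)
  have hg0 : g 0 = 0 := by
    have hp : R.point T ⟨i.1, hS i.2⟩ + ((0 : dir R T) : V T) ∈ carrier R T := by
      simpa using point_mem_carrier R (T := T) ⟨i.1, hS i.2⟩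
    rw [← (hgu 0 hp).1]
    have h1 := congrFun (Omega.pullback_eq u hS) ⟨_, point_mem_carrier R i⟩
    rw [hu0] at h1
    ext m
    have h2 := congrArg (fun f => f (fun j : Fin 0 => j.elim0)) h1
    simp only [pullback, ContinuousAlternatingMap.compContinuousLinearMap_apply, incl_point] at h2
    simp only [Submodule.coe_zero, add_zero]
    refine Eq.trans (congrArg _ (Subsingleton.elim _ _)) h2
  funext x
  obtain ⟨v, hv, rfl⟩ := exists_eq_point_add R ⟨i.1, hS i.2⟩ x
  -- The function is constant along segments issued from a vertex of `S`, where it is zero.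
  have hderiv : ∀ t ∈ Set.uIcc (0 : ℝ) 1, HasDerivAt (fun t : ℝ => g (t • v)) 0 t := by
    intro t ht
    rw [Set.uIcc_of_le zero_le_one] at ht
    have h1 := HasFDerivAt.comp_hasDerivAt (f := fun t : ℝ => t • v) t
      (hg.differentiable (by simp) (t • v)).hasFDerivAt ((hasDerivAt_id t).smul_const v)
    refine HasDerivAt.congr_deriv h1 ?_
    rw [one_smul]
    have h2 := (hgu _ (point_add_smul_mem R _ hv ht)).2
    have h3 : extDerivForm R T (u.1 T) = 0 := hu
    rw [h3] at h2
    ext m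
    have h4 := congrArg (fun f => f (fun _ : Fin 1 => v)) h2.symm
    simp only [extDeriv, ContinuousAlternatingMap.alternatizeUncurryFin_apply,
      Fin.sum_univ_succ, Finset.univ_eq_empty, Finset.sum_empty, add_zero, Fin.val_zero, pow_zero,
      one_smul] at h4
    refine Eq.trans (congrArg _ (Subsingleton.elim _ _)) h4
  have h5 := intervalIntegral.integral_eq_sub_of_hasDerivAt hderiv
    (continuous_const.intervalIntegrable _ _)
  rw [(hgu v hv).1]
  simpa [hg0] using h5.symm

theorem dir_eq_zero {T : K} (hT : T.1.card = 1) (v : dir R T) : v = 0 := by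
  have hs : Subsingleton T.1 := by
    rw [← Fintype.card_le_one_iff_subsingleton, Fintype.card_coe, hT]
  have hb : dir R T = ⊥ := vectorSpan_of_subsingleton ℝ (Set.subsingleton_range _)
  exact Subtype.ext ((Submodule.mem_bot ℝ).1 (hb ▸ v.2))

theorem eq_zero_of_card_eq_one {T : K} (hT : T.1.card = 1)
    (y : carrier R T → (dir R T) [⋀^Fin (k + 1)]→L[ℝ] ℝ) : y = 0 := by
  funext x
  ext m
  refine (y x).toAlternatingMap.map_coord_zero (i := 0) ?_
  exact dir_eq_zero R hT _

end Poincare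

/-! ### The forms attached to simplices -/

section Whitney

variable {ι : Type*} {K : PreAbstractSimplicialComplex ι} {V : K → Type*}
  [∀ T, NormedAddCommGroup (V T)] [∀ T, NormedSpace ℝ (V T)] (R : AffineRealization K V) {k : ℕ}

theorem whitneyFamily_apply (s : Fin (k + 1) → ι) (T : K) (x : carrier R T)
    (m : Fin k → dir R T) :
    whitneyFamily R s T x m = (k.factorial : ℝ) * ∑ i : Fin (k + 1),
      ((-1 : ℝ) ^ (i : ℕ) * bary R T (s i) x) *
        Matrix.det (Matrix.of fun a b => dbary R T (s (i.succAbove a)) (m b)) := by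
  simp [whitneyFamily, wedge_apply]

/-- Each summand contains either `λ_{s i}` or `dλ_{s i}`, and both vanish on `S`. -/
theorem whitneyFamily_eq_zero (s : Fin (k + 1) → ι) {S : K} {i : Fin (k + 1)}
    (hi : s i ∉ S.1) : whitneyFamily R s S = 0 := by
  funext x
  ext m
  rw [whitneyFamily_apply, Finset.sum_eq_zero, mul_zero]
  · rfl
  intro i' _
  rcases eq_or_ne i' i with rfl | hne
  · rw [bary_eq_zero R hi (carrier_subset_span R S x.2), mul_zero, zero_mul]
  · obtain ⟨a, rfl⟩ := Fin.exists_succAbove_eq hne.symm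
    rw [Matrix.det_eq_zero_of_row_eq_zero a, mul_zero]
    intro b
    rw [Matrix.of_apply, dbary_eq_zero R hi]
    rfl

/-- The form has affine coefficients, so its derivative along `|T|` is the constant `L`. Each of the
`k + 1` terms of the alternation is `k!` times the same determinant, expanded along a different
column. -/
theorem extDerivForm_whitneyFamily (s : Fin (k + 1) → ι) (T : K) :
    extDerivForm R T (whitneyFamily R s T)
      = fun _ => ((k + 1).factorial : ℝ) • wedge fun j => dbary R T (s j) := by
  funext x
  set L : dir R T →L[ℝ] (dir R T) [⋀^Fin k]→L[ℝ] ℝ := (k.factorial : ℝ) • ∑ i : Fin (k + 1),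
    (-1 : ℝ) ^ (i : ℕ) •
      (dbary R T (s i)).smulRight (wedge fun j => dbary R T (s (i.succAbove j))) with hL
  set θ : V T → (dir R T) [⋀^Fin k]→L[ℝ] ℝ := fun x => (k.factorial : ℝ) • ∑ i : Fin (k + 1),
      ((-1 : ℝ) ^ (i : ℕ) * bary R T (s i) x) • wedge fun j => dbary R T (s (i.succAbove j))
    with hθ
  have hfun : (fun v : dir R T => θ (x + v)) = fun v => θ x + L v := by
    funext v
    have hb : ∀ i, bary R T i ((x : V T) + v) = bary R T i x + dbary R T i v := fun i => by
      have := (bary R T i).map_vadd (x : V T) (v : V T)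
      rw [vadd_eq_add, vadd_eq_add, add_comm] at this
      rw [this, add_comm]
      rfl
    simp only [hθ, hL, hb, smul_apply, sum_apply,
      ContinuousLinearMap.smulRight_apply, ← smul_add, ← Finset.sum_add_distrib, smul_smul,
      mul_add, add_smul]
  have hder : HasFDerivAt (fun v : dir R T => θ (x + v)) L 0 := by
    rw [hfun]
    exact L.hasFDerivAt.const_add _
  rw [extDerivForm_eq R (u := whitneyFamily R s T) (θ := θ) (fun _ => rfl) x hder.differentiableAt, extDeriv, hder.fderiv]
  ext m
  rw [ContinuousAlternatingMap.alternatizeUncurryFin_apply,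
    ContinuousAlternatingMap.smul_apply, wedge_apply]
  set D := Matrix.det (Matrix.of fun a b => dbary R T (s a) (m b)) with hD
  have hterm : ∀ a : Fin (k + 1), (-1 : ℤ) ^ (a : ℕ) • L (m a) (a.removeNth m)
      = (k.factorial : ℝ) * D := by
    intro a
    rw [hD, Matrix.det_succ_column _ a]
    simp only [hL, smul_apply, sum_apply,
      ContinuousLinearMap.smulRight_apply, ContinuousAlternatingMap.smul_apply,
      ContinuousAlternatingMap.sum_apply, wedge_apply, smul_eq_mul, zsmul_eq_mul]
    rw [mul_left_comm, Finset.mul_sum]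
    congr 1
    refine Finset.sum_congr rfl fun i _ => ?_
    push_cast
    rw [pow_add, Matrix.of_apply]
    have : (Matrix.of fun i_1 j => dbary R T (s (i.succAbove i_1)) (a.removeNth m j))
      = (Matrix.of fun a b => dbary R T (s a) (m b)).submatrix i.succAbove a.succAbove := rfl
    rw [this]
    ring
  rw [Finset.sum_congr rfl fun a _ => hterm a]
  simp [Nat.factorial_succ]
  ring

/-- When the rows sum to zero, the maximal minors agree up to sign. This is applied to the
differentials of the barycentric coordinates, whose sum is constant. -/
theorem det_succAbove_of_sum_eq_zero {n : ℕ} (M : Matrix (Fin (n + 1)) (Fin n) ℝ)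
    (hM : ∑ j, M j = 0) (i : Fin (n + 1)) :
    (M.submatrix i.succAbove id).det = (-1) ^ (i : ℕ) * (M.submatrix Fin.succ id).det := by
  have h := Matrix.submatrix_succAbove_det_eq_negOnePow_submatrix_succAbove_det M hM i 0
  rw [h, Fin.val_zero, Nat.cast_zero, sub_zero, Int.negOnePow_def, zpow_natCast, Units.smul_def,
    zsmul_eq_mul]
  push_cast
  simp only [Fin.succAbove_zero]

/-- On a simplex, the form attached to it is a multiple of the wedge product of the differentials
of all barycentric coordinates but the first one. -/
theorem whitneyFamily_eq_wedge {T : K} (e : Fin (k + 1) ≃ T.1) :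
    whitneyFamily R (fun i => (e i).1) T
      = fun _ => (k.factorial : ℝ) • wedge fun j => dbary R T (e j.succ).1 := by
  funext x
  ext m
  rw [whitneyFamily_apply, ContinuousAlternatingMap.smul_apply, wedge_apply, smul_eq_mul]
  congr 1
  set M : Matrix (Fin (k + 1)) (Fin k) ℝ := Matrix.of fun a b => dbary R T (e a).1 (m b) with hM
  have hM0 : ∑ j, M j = 0 := by
    funext b
    refine (Finset.sum_apply b Finset.univ fun j => M j).trans ?_
    refine Eq.trans ?_ (sum_dbary R (m b))
    exact Fintype.sum_equiv e _ _ fun _ => rfl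
  have hdet := det_succAbove_of_sum_eq_zero M hM0
  -- The two signs cancel, leaving a common minor weighted by barycentric coordinates, which add up
  -- to `1`.
  have hterm : ∀ i : Fin (k + 1), ((-1 : ℝ) ^ (i : ℕ) * bary R T (e i).1 x) *
        Matrix.det (Matrix.of fun a b => dbary R T (e (i.succAbove a)).1 (m b))
      = bary R T (e i).1 x * (M.submatrix Fin.succ id).det := by
    intro i
    have h1 : Matrix.of (fun a b => dbary R T (e (i.succAbove a)).1 (m b))
      = M.submatrix i.succAbove id := rfl
    rw [h1, hdet i]
    have h2 : ((-1 : ℝ) ^ (i : ℕ)) * (-1) ^ (i : ℕ) = 1 := by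
      rw [← mul_pow]; simp
    linear_combination (bary R T (e i).1 x * (M.submatrix Fin.succ id).det) * h2
  rw [Finset.sum_congr rfl fun i _ => hterm i, ← Finset.sum_mul,
    Fintype.sum_equiv e _ (fun i : T.1 => bary R T i.1 x) (fun _ => rfl),
    sum_bary R (carrier_subset_span R T x.2), one_mul]
  rfl

/-! ### The forms `λ_T` in all degrees, and their behaviour on faces and facets -/

variable (σ : VertexOrdering K)

open Classical in
/-- The `k`-form `λ_T` if `T` is a `k`-simplex, and `0` otherwise. -/
def simplexForm (T : K) (k : ℕ) : Omega R k :=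
  if h : T.1.card = k + 1 then whitney R σ T h else 0

theorem simplexForm_of_card_ne {T : K} (h : T.1.card ≠ k + 1) : simplexForm R σ T k = 0 :=
  dif_neg h

theorem simplexForm_of_card {T : K} (h : T.1.card = k + 1) :
    simplexForm R σ T k = whitney R σ T h :=
  dif_pos h

theorem simplexForm_mem (T : K) (k : ℕ) : simplexForm R σ T k ∈ Lambda R σ k := by
  by_cases h : T.1.card = k + 1
  · rw [simplexForm_of_card R σ h]
    exact Submodule.subset_span ⟨T, h, rfl⟩
  · rw [simplexForm_of_card_ne R σ h]
    exact Submodule.zero_mem _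

theorem simplexForm_eq_zero {S T : K} (hST : ¬ T.1 ⊆ S.1) : (simplexForm R σ T k).1 S = 0 := by
  by_cases h : T.1.card = k + 1
  · rw [simplexForm_of_card R σ h]
    obtain ⟨i, hi, hiS⟩ := Finset.not_subset.1 hST
    refine whitneyFamily_eq_zero R _ (i := Fin.cast h ((σ T).symm ⟨i, hi⟩)) ?_
    simpa using hiS
  · rw [simplexForm_of_card_ne R σ h]
    rfl

/-- On `T`, both `dλ_F` and `λ_T` are `(k+1)!` times a wedge of the `dλ_j` with `j ≠ i`, so they
differ by the sign of the permutation relating the two orderings. -/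
theorem exists_facet (T : K) (hT : 2 ≤ T.1.card) :
    ∃ (i : T.1) (F : K), (∀ j, j ∈ F.1 ↔ j ∈ T.1 ∧ j ≠ i.1) ∧ F.1.card + 1 = T.1.card ∧
      ∀ k, ∃ ε : ℝ, ε ≠ 0 ∧
        (d R k (simplexForm R σ F k)).1 T = ε • (simplexForm R σ T (k + 1)).1 T := by
  classical
  -- The first vertex is removed because `whitneyFamily_eq_wedge` omits its differential.
  set i := σ T ⟨0, by omega⟩
  have hcard : (T.1.erase i.1).card + 1 = T.1.card := Finset.card_erase_add_one i.2
  set F : K := ⟨T.1.erase i.1, (K.isRelLowerSet_faces T.2).2 (Finset.erase_subset _ _)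
    (Finset.card_pos.1 (by omega))⟩ with hF
  have hmem : ∀ j, j ∈ F.1 ↔ j ∈ T.1 ∧ j ≠ i.1 := fun j => by
    rw [hF, Finset.mem_erase, and_comm]
  refine ⟨i, F, hmem, hcard, fun k => ?_⟩
  by_cases hk : T.1.card = k + 1 + 1
  · have hFk : F.1.card = k + 1 := by
      have : F.1.card + 1 = T.1.card := hcard
      omega
    rw [simplexForm_of_card R σ hk, simplexForm_of_card R σ hFk]
    let e : Fin (k + 1 + 1) ≃ T.1 := (finCongr hk.symm).trans (σ T)
    let f : Fin (k + 1) ≃ F.1 := (finCongr hFk.symm).trans (σ F)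
    have hex : ∀ j, ∃ a : Fin (k + 1), (e a.succ).1 = (f j).1 := by
      intro j
      have hj := (hmem _).1 (f j).2
      have h0 : e.symm ⟨(f j).1, hj.1⟩ ≠ 0 := by
        intro h
        rw [Equiv.symm_apply_eq] at h
        exact hj.2 (congrArg Subtype.val h)
      obtain ⟨a, ha⟩ := Fin.exists_succ_eq.2 h0
      exact ⟨a, by rw [ha, Equiv.apply_symm_apply]⟩
    choose π hπ using hex
    have hinj : Function.Injective π := fun a b hab =>
      f.injective (Subtype.ext (by rw [← hπ a, ← hπ b, hab]))
    let τ : Equiv.Perm (Fin (k + 1)) :=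
      Equiv.ofBijective π (Finite.injective_iff_bijective.1 hinj)
    refine ⟨((Equiv.Perm.sign τ : ℤ) : ℝ), by exact_mod_cast (Equiv.Perm.sign τ).ne_zero, ?_⟩
    change extDerivForm R T (whitneyFamily R (fun j => (f j).1) T)
      = _ • whitneyFamily R (fun j => (e j).1) T
    rw [extDerivForm_whitneyFamily, whitneyFamily_eq_wedge]
    funext x
    ext m
    simp only [Pi.smul_apply, ContinuousAlternatingMap.smul_apply, wedge_apply, smul_eq_mul,
      ← hπ]
    have h := Matrix.det_permute τ (Matrix.of fun a b => dbary R T (e a.succ).1 (m b))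
    rw [mul_left_comm, ← h]
    rfl
  -- In the other degrees both forms are zero, so any nonzero `ε` works.
  · refine ⟨1, one_ne_zero, ?_⟩
    have hFk : F.1.card ≠ k + 1 := by
      have : F.1.card + 1 = T.1.card := hcard
      omega
    rw [simplexForm_of_card_ne R σ hk, simplexForm_of_card_ne R σ hFk, map_zero]
    simp

/-- On a simplex with at most `k + 1` vertices, no `λ_S` other than its own survives: a different
`k`-simplex `S` cannot be contained in it. -/
theorem exists_coeff [Fintype K] {w : Omega R k} (hw : w ∈ Lambda R σ k) :
    ∃ c : K → ℝ, w = ∑ T, c T • simplexForm R σ T k ∧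
      ∀ T : K, T.1.card ≤ k + 1 → w.1 T = c T • (simplexForm R σ T k).1 T := by
  have hle : Lambda R σ k ≤ Submodule.span ℝ (Set.range fun T => simplexForm R σ T k) := by
    refine Submodule.span_mono ?_
    rintro _ ⟨T, hT, rfl⟩
    exact ⟨T, simplexForm_of_card R σ hT⟩
  obtain ⟨c, rfl⟩ := (Submodule.mem_span_range_iff_exists_fun ℝ).1 (hle hw)
  refine ⟨c, rfl, fun T hT => ?_⟩
  have hev : (∑ S, c S • simplexForm R σ S k).1 T = ∑ S, c S • (simplexForm R σ S k).1 T := by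
    simp
  rw [hev]
  refine Finset.sum_eq_single_of_mem T (Finset.mem_univ _) fun S _ hST => ?_
  by_cases hS : S.1.card = k + 1
  · rw [simplexForm_eq_zero, smul_zero]
    intro hsub
    exact hST (Subtype.ext (Finset.eq_of_subset_of_card_le hsub (by omega)))
  · rw [simplexForm_of_card_ne R σ hS]
    simp

theorem simplexForm_zero_ne_zero {T : K} (hT : T.1.card = 1) :
    (simplexForm R σ T 0).1 T ≠ 0 := by
  intro h
  rw [simplexForm_of_card R σ hT] at h
  have h1 : whitneyFamily R (fun i : Fin 1 => (σ T (Fin.cast hT.symm i)).1) T = 0 := h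
  have h2 := congrArg (fun f => f (fun j : Fin 0 => j.elim0))
    (congrFun h1 ⟨_, point_mem_carrier R (σ T (Fin.cast hT.symm 0))⟩)
  rw [whitneyFamily_apply] at h2
  simp [bary_point] at h2

end Whitney

/-! ### Closed forms are cohomologous to lowest order finite elements -/

section DeRham

variable {ι : Type*} {K : PreAbstractSimplicialComplex ι} {V : K → Type*}
  [∀ T, NormedAddCommGroup (V T)] [∀ T, NormedSpace ℝ (V T)] {R : AffineRealization K V} {k : ℕ}

theorem Omega.sub_apply (u v : Omega R k) (T : K) : (u - v).1 T = u.1 T - v.1 T := rfl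

theorem Omega.add_apply (u v : Omega R k) (T : K) : (u + v).1 T = u.1 T + v.1 T := rfl

theorem Omega.smul_apply (c : ℝ) (u : Omega R k) (T : K) : (c • u).1 T = c • u.1 T := rfl

theorem Omega.zero_apply (T : K) : (0 : Omega R k).1 T = 0 := rfl

theorem Omega.sum_apply {J : Type*} (s : Finset J) (u : J → Omega R k) (T : K) :
    (∑ j ∈ s, u j).1 T = ∑ j ∈ s, (u j).1 T := by
  simp

theorem Omega.ext_simplex {u v : Omega R k} (h : ∀ T, u.1 T = v.1 T) : u = v :=
  Subtype.ext (funext h)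

theorem Omega.eq_zero_of_subset {u : Omega R k} {S T : K} (h : S.1 ⊆ T.1) (hu : u.1 T = 0) :
    u.1 S = 0 := by
  rw [← Omega.pullback_eq u h, hu]
  rfl

theorem d_apply_congr {u v : Omega R k} {T : K} (h : u.1 T = v.1 T) :
    (d R k u).1 T = (d R k v).1 T :=
  congrArg (extDerivForm R T) h

theorem d_apply_eq_zero {u : Omega R k} {T : K} (h : u.1 T = 0) : (d R k u).1 T = 0 := by
  rw [d_apply_congr (v := 0) h, map_zero]
  rfl

/-- Makes a correction found on `T` global without disturbing the simplices that do not contain `T`.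
-/
theorem exists_extension (v : Omega R k) (T : K)
    (hv : ∀ S : K, S.1 ⊆ T.1 → S ≠ T → v.1 S = 0) :
    ∃ v' : Omega R k, v'.1 T = v.1 T ∧ ∀ S : K, ¬ T.1 ⊆ S.1 → v'.1 S = 0 :=
  ⟨⟨extendForm R T (v.1 T), extendForm_mem R (v.2.1 T)⟩, extendForm_self R T _, fun _ hS =>
    extendForm_eq_zero R (fun S h hne => (Omega.pullback_eq v h).trans (hv S h hne)) hS⟩

/-! ### Forms vanishing on the boundary of a simplex, and induction over skeleta -/

variable (σ : VertexOrdering K)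

theorem exists_union_vertex {S T : K} {i : ι} (hS : S.1 ⊆ T.1) (hi : i ∈ T.1) :
    ∃ G : K, ∀ j, j ∈ G.1 ↔ j ∈ S.1 ∨ j = i := by
  classical
  refine ⟨⟨insert i S.1, (K.isRelLowerSet_faces T.2).2 (Finset.insert_subset hi hS)
    (Finset.insert_nonempty _ _)⟩, fun j => by simp [or_comm]⟩

/-- A proper face `S` of the facet `F` lies in `S ∪ {i}`, a proper face of `T` through `i`. -/
theorem eq_zero_of_eq_zero_on_cone {T F : K} {i : ι} (hi : i ∈ T.1)
    (hF : ∀ j, j ∈ F.1 ↔ j ∈ T.1 ∧ j ≠ i) {q : Omega R k}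
    (hq : ∀ S : K, S.1 ⊆ T.1 → S ≠ T → i ∈ S.1 → q.1 S = 0) {S : K} (hS : S.1 ⊆ F.1)
    (hne : S ≠ F) : q.1 S = 0 := by
  have hST : S.1 ⊆ T.1 := fun j hj => ((hF j).1 (hS hj)).1
  obtain ⟨G, hG⟩ := exists_union_vertex hST hi
  refine Omega.eq_zero_of_subset (T := G) (fun j hj => (hG j).2 (.inl hj))
    (hq G (fun j hj => ?_) (fun h => hne ?_) ((hG i).2 (.inr rfl)))
  · rcases (hG j).1 hj with h | rfl
    exacts [hST h, hi]
  · refine Subtype.ext (Finset.Subset.antisymm hS fun j hj => ?_)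
    have hj' := (hF j).1 hj
    exact ((hG j).1 (h ▸ hj'.1)).resolve_right hj'.2

/-- The form attached to a simplex is not the derivative of a form vanishing on the boundary. -/
theorem coeff_eq_zero {T : K} (hT : T.1.card = k + 2) {z : Omega R k} {c : ℝ}
    (hz : ∀ S : K, S.1 ⊆ T.1 → S ≠ T → z.1 S = 0)
    (hd : (d R k z).1 T = c • (simplexForm R σ T (k + 1)).1 T) : c = 0 := by
  induction k generalizing T c with
  | zero =>
    obtain ⟨i, F, hF, hFc, hε⟩ := exists_facet R σ T (by omega)
    obtain ⟨ε, hε0, hε⟩ := hε 0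
    have hFT : F.1 ⊆ T.1 := fun j hj => ((hF j).1 hj).1
    have hFne : F ≠ T := fun h => by rw [h] at hFc; omega
    obtain ⟨j, hj⟩ := nonempty_simplex F
    obtain ⟨G, hG⟩ : ∃ G : K, ∀ j, j ∈ G.1 ↔ j = i.1 :=
      ⟨⟨{i.1}, (K.isRelLowerSet_faces T.2).2 (Finset.singleton_subset_iff.2 i.2)
        (Finset.singleton_nonempty _)⟩, fun j => Finset.mem_singleton⟩
    have hGT : G.1 ⊆ T.1 := fun a ha => by rw [(hG a).1 ha]; exact i.2
    have hGne : G ≠ T := fun h =>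
      ((hF j).1 hj).2 ((hG j).1 (h ▸ hFT hj))
    have hFG : ¬ F.1 ⊆ G.1 := fun h => ((hF j).1 hj).2 ((hG j).1 (h hj))
    -- On the edge `T` this function is closed and vanishes at the vertex `i`, hence also at `F`,
    -- where `z` is zero and `λ_F` is not.
    have h0 := eq_zero_of_closed (z - (c / ε) • simplexForm R σ F 0) hGT
      (by rw [map_sub, map_smul, Omega.sub_apply, Omega.smul_apply, hd, hε, smul_smul,
            div_mul_cancel₀ _ hε0, sub_self])
      (by rw [Omega.sub_apply, Omega.smul_apply, hz G hGT hGne, simplexForm_eq_zero R σ hFG,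
            smul_zero, sub_zero])
    have h1 := Omega.eq_zero_of_subset hFT h0
    rw [Omega.sub_apply, Omega.smul_apply, hz F hFT hFne, zero_sub, neg_eq_zero, smul_eq_zero,
      div_eq_zero_iff] at h1
    exact (h1.resolve_right (simplexForm_zero_ne_zero R σ (by omega))).resolve_right hε0
  | succ k ih =>
    obtain ⟨i, F, hF, hFc, hε⟩ := exists_facet R σ T (by omega)
    obtain ⟨ε, hε0, hε⟩ := hε (k + 1)
    have hFT : F.1 ⊆ T.1 := fun j hj => ((hF j).1 hj).1
    have hFne : F ≠ T := fun h => by rw [h] at hFc; omega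
    -- The subtracted multiple makes the form closed on `T`. It vanishes on the proper faces through
    -- `i`, as these do not contain `F`, so `q` vanishes there and satisfies the induction
    -- hypothesis on `F`.
    obtain ⟨q, hq, hq0⟩ := exists_primitive (z - (c / ε) • simplexForm R σ F (k + 1)) T i
      (by rw [map_sub, map_smul, Omega.sub_apply, Omega.smul_apply, hd, hε, smul_smul,
            div_mul_cancel₀ _ hε0, sub_self])
    have hqF : (d R k q).1 F = (-(c / ε)) • (simplexForm R σ F (k + 1)).1 F := by
      rw [← Omega.pullback_eq _ hFT, hq, Omega.pullback_eq _ hFT, Omega.sub_apply,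
        Omega.smul_apply, hz F hFT hFne, zero_sub, neg_smul]
    have h1 := ih (T := F) (by omega) (fun S hS hne => eq_zero_of_eq_zero_on_cone i.2 hF
      (fun G hGT hGne hiG => hq0 G hGT hiG ?_) hS hne) hqF
    · rw [neg_eq_zero, div_eq_zero_iff] at h1
      exact h1.resolve_right hε0
    · have hFG : ¬ F.1 ⊆ G.1 := fun h => hGne <| Subtype.ext <|
        Finset.Subset.antisymm hGT fun j hj => by
          by_cases hji : j = i.1
          · exact hji ▸ hiG
          · exact h ((hF j).2 ⟨hj, hji⟩)
      rw [Omega.sub_apply, Omega.smul_apply, hz G hGT hGne, simplexForm_eq_zero R σ hFG,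
        smul_zero, sub_zero]

/-- `|T|` is a single point, so functions on it form a line. -/
theorem exists_eq_smul_of_card_eq_one {T : K} (hT : T.1.card = 1)
    (y : carrier R T → (dir R T) [⋀^Fin 0]→L[ℝ] ℝ)
    {z : carrier R T → (dir R T) [⋀^Fin 0]→L[ℝ] ℝ} (hz : z ≠ 0) : ∃ c : ℝ, y = c • z := by
  obtain ⟨j⟩ := nonempty_simplex T
  have hx : ∀ x : carrier R T, x = ⟨_, point_mem_carrier R j⟩ := fun x => by
    obtain ⟨v, h, rfl⟩ := exists_eq_point_add R j x
    exact Subtype.ext (by simp [dir_eq_zero R hT v])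
  have hne : z ⟨_, point_mem_carrier R j⟩ (fun a => a.elim0) ≠ 0 := by
    intro h
    refine hz (funext fun x => ?_)
    ext m
    rw [hx x]
    exact (congrArg _ (Subsingleton.elim _ _)).trans h
  refine ⟨y ⟨_, point_mem_carrier R j⟩ (fun a => a.elim0) /
    z ⟨_, point_mem_carrier R j⟩ (fun a => a.elim0), funext fun x => ?_⟩
  ext m
  rw [hx x, Pi.smul_apply, ContinuousAlternatingMap.smul_apply,
    Subsingleton.elim m fun a => a.elim0, smul_eq_mul, div_mul_cancel₀ _ hne]

theorem d_coboundary {b : Omega R k} (hb : b ∈ coboundaries R (fun _ => ⊤) k) :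
    d R k b = 0 :=
  (coboundaries_le_cocycles R (S := fun _ => ⊤) (fun _ _ _ => trivial) k hb).2

/-- A closed form on a simplex vanishing on its boundary is a multiple of the form attached to
the simplex, up to the derivative of a form vanishing on the boundary. -/
theorem exists_relative_primitive {T : K} {u : Omega R k} (hd : (d R k u).1 T = 0)
    (hu : ∀ S : K, S.1 ⊆ T.1 → S ≠ T → u.1 S = 0) :
    ∃ (c : ℝ) (b : Omega R k), b ∈ coboundaries R (fun _ => ⊤) k ∧
      u.1 T = c • (simplexForm R σ T k).1 T + b.1 T ∧ ∀ S : K, ¬ T.1 ⊆ S.1 → b.1 S = 0 := by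
  have hpos : T.1.card ≠ 0 := (Finset.card_pos.2 (K.isRelLowerSet_faces T.2).1).ne'
  induction k generalizing T with
  | zero =>
    by_cases hT : T.1.card = 1
    · obtain ⟨c, hc⟩ := exists_eq_smul_of_card_eq_one hT (u.1 T)
        (simplexForm_zero_ne_zero R σ hT)
      exact ⟨c, 0, Submodule.zero_mem _, hc.trans (add_zero _).symm, fun S _ => rfl⟩
    · obtain ⟨i, F, hF, hFc, -⟩ := exists_facet R σ T (by omega)
      have hFT : F.1 ⊆ T.1 := fun j hj => ((hF j).1 hj).1
      refine ⟨0, 0, Submodule.zero_mem _, ?_, fun S _ => rfl⟩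
      rw [zero_smul, zero_add, Omega.zero_apply]
      exact eq_zero_of_closed u hFT hd (hu F hFT fun h => by rw [h] at hFc; omega)
  | succ k ih =>
    by_cases hT : T.1.card = 1
    · refine ⟨0, 0, Submodule.zero_mem _, ?_, fun S _ => rfl⟩
      rw [zero_smul, zero_add, Omega.zero_apply]
      exact eq_zero_of_card_eq_one R hT _
    obtain ⟨i, F, hF, hFc, hε⟩ := exists_facet R σ T (by omega)
    obtain ⟨ε, -, hε⟩ := hε k
    have hFT : F.1 ⊆ T.1 := fun j hj => ((hF j).1 hj).1
    have hFne : F ≠ T := fun h => by rw [h] at hFc; omega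
    have hFG : ∀ G : K, G.1 ⊆ T.1 → G ≠ T → i.1 ∈ G.1 → ¬ F.1 ⊆ G.1 :=
      fun G hGT hGne hiG h => hGne <| Subtype.ext <|
        Finset.Subset.antisymm hGT fun j hj => by
          by_cases hji : j = i.1
          · exact hji ▸ hiG
          · exact h ((hF j).2 ⟨hj, hji⟩)
    obtain ⟨v, hv, hv0⟩ := exists_primitive u T i hd
    have hvi : ∀ G : K, G.1 ⊆ T.1 → G ≠ T → i.1 ∈ G.1 → v.1 G = 0 :=
      fun G hGT hGne hiG => hv0 G hGT hiG (hu G hGT hGne)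
    -- The primitive `v` is closed on `F`, since `u` vanishes there, and it vanishes on the boundary
    -- of `F`.
    obtain ⟨c, b, hb, hvF, hb0⟩ := ih (T := F) (u := v)
      (by rw [← Omega.pullback_eq _ hFT, hv, Omega.pullback_eq _ hFT, hu F hFT hFne])
      (fun S hS hne => eq_zero_of_eq_zero_on_cone i.2 hF hvi hS hne) (by omega)
    -- The corrected primitive vanishes on the whole boundary: on `F` by the choice of `c` and `b`,
    -- and on the faces through `i` term by term.
    obtain ⟨v', hv', hv'0⟩ := exists_extension (v - c • simplexForm R σ F k - b) T (by
      intro S hS hne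
      by_cases hiS : i.1 ∈ S.1
      · rw [Omega.sub_apply, Omega.sub_apply, Omega.smul_apply, hvi S hS hne hiS,
          simplexForm_eq_zero R σ (hFG S hS hne hiS), hb0 S (hFG S hS hne hiS)]
        simp
      · refine Omega.eq_zero_of_subset (T := F) (fun j hj => (hF j).2 ⟨hS hj, ?_⟩) ?_
        · rintro rfl
          exact hiS hj
        · rw [Omega.sub_apply, Omega.sub_apply, Omega.smul_apply, hvF]
          abel)
    -- On `T`, `u = dv = dv' + c dλ_F + db`, where `db = 0` and `dλ_F = ε λ_T`.
    refine ⟨c * ε, d R k v', ⟨v', trivial, rfl⟩, ?_, fun S hS => d_apply_eq_zero (hv'0 S hS)⟩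
    rw [d_apply_congr hv', map_sub, map_sub, map_smul, d_coboundary hb, sub_zero,
      Omega.sub_apply, Omega.smul_apply, hv, hε, smul_smul]
    abel

theorem simplexForm_self_ne_zero {T : K} (hT : T.1.card = k + 1) :
    (simplexForm R σ T k).1 T ≠ 0 := by
  cases k with
  | zero => exact simplexForm_zero_ne_zero R σ hT
  | succ k =>
    intro h
    -- If `λ_T` were zero on `T`, it would be the derivative of the zero form.
    refine one_ne_zero (coeff_eq_zero (c := 1) (z := (0 : Omega R k)) σ hT (fun _ _ _ => rfl) ?_)
    rw [h, smul_zero, map_zero]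
    rfl

/-- The elements of `Λ^k` are determined by their restrictions to the `k`-simplices. -/
theorem eq_zero_of_mem_Lambda [Finite K] {w : Omega R k} (hw : w ∈ Lambda R σ k)
    (h : ∀ T : K, T.1.card = k + 1 → w.1 T = 0) : w = 0 := by
  have := Fintype.ofFinite K
  obtain ⟨c, hc, hcT⟩ := exists_coeff R σ hw
  rw [hc]
  refine Finset.sum_eq_zero fun T _ => ?_
  by_cases hT : T.1.card = k + 1
  · have h1 := (hcT T hT.le).symm.trans (h T hT)
    rw [(smul_eq_zero.1 h1).resolve_right (simplexForm_self_ne_zero σ hT), zero_smul]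
  · rw [simplexForm_of_card_ne R σ hT, smul_zero]

/-- If the derivative of `z` is in `Λ^{k+1}` and `z` vanishes on the simplices of dimension
smaller than that of `T`, then `z` is closed on `T`. -/
theorem d_eq_zero_of_mem_Lambda [Finite K] {z : Omega R k}
    (hd : d R k z ∈ Lambda R σ (k + 1)) {T : K}
    (hz : ∀ S : K, S.1.card < T.1.card → z.1 S = 0) : (d R k z).1 T = 0 := by
  have := Fintype.ofFinite K
  by_cases hT : T.1.card ≤ k + 2
  · obtain ⟨c, -, hcT⟩ := exists_coeff R σ hd
    rw [hcT T hT]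
    by_cases hTk : T.1.card = k + 2
    · have hc := coeff_eq_zero σ hTk (fun S hS hne => hz S (Finset.card_lt_card
        (hS.ssubset_of_ne fun h => hne (Subtype.ext h)))) (hcT T hT)
      rw [hc, zero_smul]
    · rw [simplexForm_of_card_ne R σ hTk, Omega.zero_apply, smul_zero]
  -- Here `T` has more than `k + 2` vertices, so `z` vanishes on every `(k+1)`-simplex and `dz` is
  -- zero everywhere.
  · rw [eq_zero_of_mem_Lambda σ hd fun S hS => d_apply_eq_zero (hz S (by omega))]
    rfl

/-- Every closed compatible form is cohomologous to a lowest order finite element. -/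
theorem mem_Lambda_sup_coboundaries [Finite K]
    (hΛ : ∀ k, ∀ w ∈ Lambda R σ k, d R k w ∈ Lambda R σ (k + 1))
    {u : Omega R k} (hu : d R k u = 0) :
    u ∈ Lambda R σ k ⊔ coboundaries R (fun _ => ⊤) k := by
  classical
  have := Fintype.ofFinite K
  set N := Lambda R σ k ⊔ coboundaries R (fun _ => ⊤) k
  have hdN : ∀ n ∈ N, d R k n ∈ Lambda R σ (k + 1) := by
    intro n hn
    obtain ⟨w, hw, b, hb, rfl⟩ := Submodule.mem_sup.1 hn
    rw [map_add, d_coboundary hb, add_zero]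
    exact hΛ k w hw
  have hskel : ∀ m : ℕ, ∃ n ∈ N, ∀ S : K, S.1.card ≤ m → (u - n).1 S = 0 := by
    intro m
    induction m with
    | zero =>
      refine ⟨0, N.zero_mem, fun S hS => ?_⟩
      have := Finset.card_pos.2 (K.isRelLowerSet_faces S.2).1
      omega
    | succ m ih =>
      obtain ⟨n, hn, hz⟩ := ih
      have hdz : d R k (u - n) ∈ Lambda R σ (k + 1) := by
        rw [map_sub, hu, zero_sub]
        exact Submodule.neg_mem _ (hdN n hn)
      have hloc : ∀ T : K, ∃ r ∈ N, (T.1.card = m + 1 → r.1 T = (u - n).1 T) ∧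
          ∀ S : K, ¬ T.1 ⊆ S.1 → r.1 S = 0 := by
        intro T
        by_cases hT : T.1.card = m + 1
        · obtain ⟨c, b, hb, hcb, hb0⟩ := exists_relative_primitive (T := T) σ
            (d_eq_zero_of_mem_Lambda σ hdz fun S hS => hz S (by omega))
            (fun S hS hne => hz S (by
              have := Finset.card_lt_card (hS.ssubset_of_ne fun h => hne (Subtype.ext h))
              omega))
          refine ⟨c • simplexForm R σ T k + b, Submodule.add_mem_sup
            (Submodule.smul_mem _ _ (simplexForm_mem R σ T k)) hb, fun _ => hcb.symm,
            fun S hS => ?_⟩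
          rw [Omega.add_apply, Omega.smul_apply, simplexForm_eq_zero R σ hS, hb0 S hS, smul_zero,
            add_zero]
        · exact ⟨0, N.zero_mem, fun h => absurd h hT, fun _ _ => rfl⟩
      choose r hrN hrT hr0 using hloc
      refine ⟨n + ∑ T with T.1.card = m + 1, r T,
        N.add_mem hn (N.sum_mem fun T _ => hrN T), fun S hS => ?_⟩
      rw [← sub_sub, Omega.sub_apply, Omega.sum_apply]
      -- Corrections attached to different simplices of the same size do not interfere, and none of
      -- them affects a smaller simplex.
      have hsub : ∀ T : K, T.1.card = m + 1 → T ≠ S → ¬ T.1 ⊆ S.1 := fun T hT hne h =>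
        hne (Subtype.ext (Finset.eq_of_subset_of_card_le h (by omega)))
      by_cases hSm : S.1.card = m + 1
      · rw [Finset.sum_eq_single_of_mem S (by simpa using hSm) fun T hT hne =>
          hr0 T S (hsub T (by simpa using hT) hne), hrT S hSm, sub_self]
      · rw [hz S (by omega), Finset.sum_eq_zero fun T hT => hr0 T S (hsub T (by simpa using hT) ?_),
          sub_zero]
        rintro rfl
        exact hSm (by simpa using hT)
  obtain ⟨n, hn, h⟩ := hskel (Finset.univ.sup fun T : K => T.1.card)
  have hun : u - n = 0 := Omega.ext_simplex fun T =>
    h T (Finset.le_sup (f := fun T : K => T.1.card) (Finset.mem_univ T))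
  rwa [sub_eq_zero.1 hun]

/-! ### The map induced on cohomology -/

variable {Γ : ∀ k : ℕ, Submodule ℝ (Omega R k)}
  {P : ∀ k : ℕ, Omega R k →ₗ[ℝ] Omega R k}

/-- An interpolator maps coboundaries to coboundaries. -/
theorem IsInterpolator.map_coboundary (hP : IsInterpolator R Γ P)
    {S : ∀ k : ℕ, Submodule ℝ (Omega R k)} {b : Omega R k} (hb : b ∈ coboundaries R S k) :
    P k b ∈ coboundaries R Γ k := by
  cases k with
  | zero =>
    rw [(Submodule.mem_bot ℝ).1 hb, map_zero]
    exact Submodule.zero_mem _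
  | succ k =>
    obtain ⟨v, -, rfl⟩ := hb
    exact ⟨P k v, (hP.isProj k).map_mem v, hP.comm k v⟩

theorem cohomologyMap_mk {S S' : ∀ k, Submodule ℝ (Omega R k)} (h : ∀ k, S k ≤ S' k) (k : ℕ)
    (x : cocycles R S k) :
    cohomologyMap R h k (Submodule.Quotient.mk x)
      = Submodule.Quotient.mk (Submodule.inclusion (cocycles_mono R h k) x) := rfl

theorem cohomologyMap_injective (h : ∀ k, Lambda R σ k ≤ Γ k)
    (hP : IsInterpolator R (Lambda R σ) P) (k : ℕ) :
    Function.Injective (cohomologyMap R h k) := by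
  rw [injective_iff_map_eq_zero]
  intro x hx
  obtain ⟨⟨u, hu⟩, rfl⟩ := Submodule.Quotient.mk_surjective _ x
  rw [cohomologyMap_mk, Submodule.Quotient.mk_eq_zero] at hx
  rw [Submodule.Quotient.mk_eq_zero]
  have h1 := hP.map_coboundary (b := u) hx
  rwa [(hP.isProj k).map_id u hu.1] at h1

theorem cohomologyMap_surjective [Finite K] (h : ∀ k, Lambda R σ k ≤ Γ k)
    (hΛ : ∀ k, ∀ w ∈ Lambda R σ k, d R k w ∈ Lambda R σ (k + 1))
    (hP : IsInterpolator R Γ P) (k : ℕ) :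
    Function.Surjective (cohomologyMap R h k) := by
  intro x
  obtain ⟨⟨u, hu⟩, rfl⟩ := Submodule.Quotient.mk_surjective _ x
  obtain ⟨w, hw, b, hb, hwb⟩ := Submodule.mem_sup.1 (mem_Lambda_sup_coboundaries σ hΛ hu.2)
  have hdw : d R k w = 0 := by
    have h1 : d R k u = 0 := hu.2
    rwa [← hwb, map_add, d_coboundary hb, add_zero] at h1
  refine ⟨Submodule.Quotient.mk ⟨w, hw, hdw⟩, ?_⟩
  rw [cohomologyMap_mk, Submodule.Quotient.eq]
  change w - u ∈ coboundaries R Γ k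
  -- The primitive of `b` lies only in `Ω`; projecting moves it into `Γ` and leaves `b = u - w`
  -- unchanged.
  have h2 := hP.map_coboundary hb
  rw [eq_sub_of_add_eq' hwb, map_sub, (hP.isProj k).map_id u hu.1,
    (hP.isProj k).map_id w (h k hw)] at h2
  rw [← neg_sub]
  exact Submodule.neg_mem _ h2

end DeRham

end CompatibleForms

end

theorem proposition3p8 {ι : Type*} (K : PreAbstractSimplicialComplex ι) [Finite K]
    (V : K → Type*) [∀ T, NormedAddCommGroup (V T)] [∀ T, NormedSpace ℝ (V T)]
    (R : CompatibleForms.AffineRealization K V) (σ : CompatibleForms.VertexOrdering K)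
    (Γ : ∀ k : ℕ, Submodule ℝ (CompatibleForms.Omega R k))
    (hΛΓ : ∀ k, CompatibleForms.Lambda R σ k ≤ Γ k)
    (hΓ : ∀ k, ∀ u ∈ Γ k, CompatibleForms.d R k u ∈ Γ (k + 1))
    (PΓ PΛ : ∀ k : ℕ, CompatibleForms.Omega R k →ₗ[ℝ] CompatibleForms.Omega R k)
    (hPΓ : CompatibleForms.IsInterpolator R Γ PΓ)
    (hPΛ : CompatibleForms.IsInterpolator R (CompatibleForms.Lambda R σ) PΛ)
    (hcomp : ∀ k, PΛ k ∘ₗ PΓ k = PΛ k) :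
    ∀ k : ℕ, Function.Bijective (CompatibleForms.cohomologyMap R hΛΓ k) := by
  exact fun k => ⟨CompatibleForms.cohomologyMap_injective σ hΛΓ hPΛ k,
    CompatibleForms.cohomologyMap_surjective σ hΛΓ (fun _ _ => hPΛ.d_mem) hPΓ k⟩
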